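/- For complex $a,q$ and $n\in\mathbb Z_{\ge 0}$ let $(a;q)_n=\prod_{m=0}^{n-1}(1-aq^m)$, and for $|q|<1$ let $(a;q)_\infty=\prod_{m=0}^{\infty}(1-aq^m)$ and $J_m=(q^m;q^m)_\infty$. For $|q|<1$ put $$S_1(q)=\sum_{i,j,k\ge 0}\frac{q^{\frac32 i^2+2j^2+4k^2+2ij+4ik+4jk+\frac12 i+j}}{(q;q)_i(q^2;q^2)_j(q^2;q^2)_k},\qquad S_2(q)=\sum_{i,j,k\ge 0}\frac{q^{\frac32 i^2+2j^2+4k^2+2ij+4ik+4jk+\frac52 i+3j+4k}}{(q;q)_i(q^2;q^2)_j(q^2;q^2)_k}.$$ Both series converge absolutely, and $$S_1(q)=\frac14\left(3\frac{J_2}{J_1}+\frac{J_1^3}{J_2}\right)\quad(|q|<1),\qquad S_2(q)=\frac{1}{4}q^{-1}\left(\frac{J_2}{J_1}-\frac{J_1^3}{J_2}\right)\quad(0<|q|<1).$$ Moreover, let $q=e^{2\pi i\tau}$ with $\operatorname{Im}\tau>0$, write $q^{c}=e^{2\pi i c\tau}$ for $c\in\mathbb Q$, and let $\eta(\tau)=q^{1/24}(q;q)_\infty$.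 Then $$q^{1/24}S_1(q)=\frac34\,\frac{\eta(2\tau)}{\eta(\tau)}+\frac14\,\frac{\eta(\tau)^3}{\eta(2\tau)},\qquad q^{25/24}S_2(q)=\frac14\,\frac{\eta(2\tau)}{\eta(\tau)}-\frac14\,\frac{\eta(\tau)^3}{\eta(2\tau)},$$ and there is a finite-index subgroup $\Gamma\le \mathrm{SL}_2(\mathbb Z)$ such that $\eta(2\tau)/\eta(\tau)$ is a weakly holomorphic modular form of weight $0$ for $\Gamma$ (holomorphic on the upper half-plane, meromorphic at the cusps) and $\eta(\tau)^3/\eta(2\tau)$ is a modular form of weight $1$ for $\Gamma$ (holomorphic also at the cusps). So $q^{1/24}S_1(q)$ and $q^{25/24}S_2(q)$ are sums of modular forms of weights $0$ and $1$. -/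

import Mathlib

open scoped MatrixGroups UpperHalfPlane Manifold ModularForm

/-- The finite `q`-Pochhammer symbol `(a; q)_n = ∏_{0 ≤ m < n} (1 - a q^m)`. -/
noncomputable def qPoch (a q : ℂ) (n : ℕ) : ℂ :=
  ∏ m ∈ Finset.range n, (1 - a * q ^ m)

/-- The infinite `q`-Pochhammer symbol `(a; q)_∞ = ∏_{m ≥ 0} (1 - a q^m)`, used for `|q| < 1`. -/
noncomputable def qPochInf (a q : ℂ) : ℂ :=
  ∏' m : ℕ, (1 - a * q ^ m)

/-- The product defining `(a; q)_∞` converges for `|q| < 1`. -/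
theorem multipliable_qPochInf (a q : ℂ) (hq : ‖q‖ < 1) :
    Multipliable fun m : ℕ => 1 - a * q ^ m := by
  have h : Summable fun m : ℕ => ‖-(a * q ^ m)‖ := by
    simpa using (summable_geometric_of_lt_one (norm_nonneg q) hq).mul_left ‖a‖
  simpa [sub_eq_add_neg] using multipliable_one_add_of_summable h

/-- The exponent `(3/2)i² + 2j² + 4k² + 2ij + 4ik + 4jk + (1/2)i + j`, a natural number. -/
def expo₁ (i j k : ℕ) : ℕ :=
  (3 * i ^ 2 + i) / 2 + 2 * j ^ 2 + 4 * k ^ 2 + 2 * i * j + 4 * i * k + 4 * j * k + j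

/-- The exponent `(3/2)i² + 2j² + 4k² + 2ij + 4ik + 4jk + (5/2)i + 3j + 4k`, a natural number. -/
def expo₂ (i j k : ℕ) : ℕ :=
  (3 * i ^ 2 + 5 * i) / 2 + 2 * j ^ 2 + 4 * k ^ 2 + 2 * i * j + 4 * i * k + 4 * j * k
    + 3 * j + 4 * k

theorem expo₁_cast (i j k : ℕ) :
    (expo₁ i j k : ℚ) = 3 / 2 * i ^ 2 + 2 * j ^ 2 + 4 * k ^ 2 + 2 * i * j + 4 * i * k
      + 4 * j * k + 1 / 2 * i + j := by
  have h : 2 ∣ 3 * i ^ 2 + i := by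
    rcases Nat.even_or_odd' i with ⟨m, rfl | rfl⟩
    · exact ⟨6 * m ^ 2 + m, by ring⟩
    · exact ⟨6 * m ^ 2 + 7 * m + 2, by ring⟩
  unfold expo₁
  push_cast [Nat.cast_div h (by norm_num : ((2 : ℕ) : ℚ) ≠ 0)]
  ring

theorem expo₂_cast (i j k : ℕ) :
    (expo₂ i j k : ℚ) = 3 / 2 * i ^ 2 + 2 * j ^ 2 + 4 * k ^ 2 + 2 * i * j + 4 * i * k
      + 4 * j * k + 5 / 2 * i + 3 * j + 4 * k := by
  have h : 2 ∣ 3 * i ^ 2 + 5 * i := by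
    rcases Nat.even_or_odd' i with ⟨m, rfl | rfl⟩
    · exact ⟨6 * m ^ 2 + 5 * m, by ring⟩
    · exact ⟨6 * m ^ 2 + 11 * m + 4, by ring⟩
  unfold expo₂
  push_cast [Nat.cast_div h (by norm_num : ((2 : ℕ) : ℚ) ≠ 0)]
  ring

/-- The `(i, j, k)`-term `q^{expo₁ i j k} / ((q;q)_i (q²;q²)_j (q²;q²)_k)`. -/
noncomputable def nahmTerm₁ (q : ℂ) (n : ℕ × ℕ × ℕ) : ℂ :=
  q ^ expo₁ n.1 n.2.1 n.2.2 /
    (qPoch q q n.1 * qPoch (q ^ 2) (q ^ 2) n.2.1 * qPoch (q ^ 2) (q ^ 2) n.2.2)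

/-- The `(i, j, k)`-term `q^{expo₂ i j k} / ((q;q)_i (q²;q²)_j (q²;q²)_k)`. -/
noncomputable def nahmTerm₂ (q : ℂ) (n : ℕ × ℕ × ℕ) : ℂ :=
  q ^ expo₂ n.1 n.2.1 n.2.2 /
    (qPoch q q n.1 * qPoch (q ^ 2) (q ^ 2) n.2.1 * qPoch (q ^ 2) (q ^ 2) n.2.2)

/-- `f` is a weakly holomorphic modular form of weight `k` for the subgroup `Γ` of `SL(2, ℤ)`:
it is holomorphic on the upper half-plane, invariant under the weight `k` slash action of `Γ`, and
meromorphic at every cusp, i.e. each `f ∣[k] γ` becomes bounded at `i∞` after multiplication by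
some power of `q = exp(2πiτ)`. -/
structure IsWeaklyHolomorphicModularForm (Γ : Subgroup SL(2, ℤ)) (k : ℤ) (f : ℍ → ℂ) : Prop where
  holo : MDiff f
  slash_eq : ∀ γ ∈ Γ, f ∣[k] γ = f
  meromorphic_at_cusps : ∀ γ : SL(2, ℤ), ∃ m : ℕ, UpperHalfPlane.IsBoundedAtImInfty
    (fun τ : ℍ => Complex.exp (2 * Real.pi * Complex.I * (τ : ℂ)) ^ m * (f ∣[k] γ) τ)

/-- The eta quotient `η(2τ) / η(τ)`, which is `q^{1/24} (q²;q²)_∞ / (q;q)_∞`. -/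
noncomputable def etaQuotient₀ (τ : ℍ) : ℂ :=
  ModularForm.eta (2 * (τ : ℂ)) / ModularForm.eta (τ : ℂ)

/-- The eta quotient `η(τ)³ / η(2τ)`, which is `q^{1/24} (q;q)_∞³ / (q²;q²)_∞`. -/
noncomputable def etaQuotient₁ (τ : ℍ) : ℂ :=
  ModularForm.eta (τ : ℂ) ^ 3 / ModularForm.eta (2 * (τ : ℂ))

/-! With `δ = 0` for the first series and `δ = 1` for the second (whose exponent is raised by 1),
the exponent is `N² + i(i+1)/2 + (j²+j)`, `N = i+j+2k+δ`. Dividing by `(q²;q²)_∞` and expanding by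
Durfee rectangles in base `q²` replaces `q^{N²}` by `∑_s q^{(N+s)²} q^{s²} / ((q²;q²)_s
(q²;q²)_{N+s})`. Collecting `m = i+j+2k+s` leaves `∑_m q^{(m+δ)²} c_m / (q²;q²)_{m+δ}`, where `c_m`
is the coefficient of `z^m` in `(-zq;q)_∞ (-zq²;q²)_∞ (-zq;q²)_∞ / (z²;q²)_∞ = (1+z)⁻¹ (-zq;q)_∞ /
(z;q)_∞`. Hence `c_m + c_{m-1} = (-q;q)_m / (q;q)_m`, and `coeff_genA_sq_mul_genK` gives `c_m =
(q²;q²)_{m+1} β_{m+1}` with `β` = `baileyBeta`.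

The matching `α_r` is, up to sign, the mean of two consecutive partial sums `θ_r` of Gauss's theta
series. The limiting Bailey lemma turns `∑ q^{n²} β_n` into `(q;q)_∞⁻¹ ∑ q^{(r+1)²} α_r`, which
telescopes to `(1 - θ_∞²) / (4 (q;q)_∞)` with `θ_∞ = J₁²/J₂`. The constant 1 yields the weight 0
part, and `θ_∞²` the weight 1 part.

For modularity, the 24th powers of the eta quotients are quotients of products of `Δ(τ)` and
`Δ(2τ)`. So each quotient transforms under `Γ₀(2)` by a character into 24th roots of unity, whose
kernel has finite index. Growth at the cusps is read off from `Δ(2τ)|γ = Δ|T` with `T` upper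
triangular. -/

open Filter Topology Finset

/-! ### Finite and infinite q-Pochhammer symbols. -/

section QPochhammer

theorem qPoch_zero (a q : ℂ) : qPoch a q 0 = 1 := by simp [qPoch]

theorem qPoch_succ (a q : ℂ) (n : ℕ) : qPoch a q (n + 1) = qPoch a q n * (1 - a * q ^ n) := by
  simp [qPoch, Finset.prod_range_succ]

theorem qPoch_self_succ (q : ℂ) (n : ℕ) : qPoch q q (n + 1) = qPoch q q n * (1 - q ^ (n + 1)) := by
  rw [qPoch_succ, pow_succ']

theorem one_sub_pow_succ_ne_zero {q : ℂ} (hq : ‖q‖ < 1) (n : ℕ) : 1 - q ^ (n + 1) ≠ 0 := by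
  intro h
  have h1 : ‖q ^ (n + 1)‖ = 1 := by rw [← sub_eq_zero.mp h, norm_one]
  rw [norm_pow] at h1
  exact (pow_lt_one₀ (norm_nonneg q) hq n.succ_ne_zero).ne h1

theorem qPoch_self_ne_zero {q : ℂ} (hq : ‖q‖ < 1) (n : ℕ) : qPoch q q n ≠ 0 := by
  induction n with
  | zero => simp [qPoch_zero]
  | succ n ih => rw [qPoch_self_succ]; exact mul_ne_zero ih (one_sub_pow_succ_ne_zero hq n)

theorem inv_qPoch_self_eq {q : ℂ} (hq : ‖q‖ < 1) (n : ℕ) :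
    (qPoch q q n)⁻¹ = (1 - q ^ (n + 1)) * (qPoch q q (n + 1))⁻¹ := by
  have := one_sub_pow_succ_ne_zero hq n
  have := qPoch_self_ne_zero hq n
  rw [qPoch_self_succ]
  field_simp

theorem norm_sq_lt_one {q : ℂ} (hq : ‖q‖ < 1) : ‖q ^ 2‖ < 1 := by
  rw [norm_pow]; exact pow_lt_one₀ (norm_nonneg q) hq two_ne_zero

/-- `(q²; q²)_n = (q; q)_n (-q; q)_n`. -/
theorem qPoch_sq (q : ℂ) (n : ℕ) : qPoch (q ^ 2) (q ^ 2) n = qPoch q q n * qPoch (-q) q n := by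
  simp only [qPoch, ← Finset.prod_mul_distrib]
  exact Finset.prod_congr rfl fun m _ => by ring

theorem qPochInf_self_ne_zero {q : ℂ} (hq : ‖q‖ < 1) : qPochInf q q ≠ 0 := by
  have h : Summable fun m : ℕ => ‖-(q * q ^ m)‖ := by
    simpa using (summable_geometric_of_lt_one (norm_nonneg q) hq).mul_left ‖q‖
  have := tprod_one_add_ne_zero_of_summable (f := fun m : ℕ => -(q * q ^ m))
    (fun m => by simpa [← sub_eq_add_neg, ← pow_succ'] using one_sub_pow_succ_ne_zero hq m) h
  simpa [qPochInf, sub_eq_add_neg] using this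

theorem tendsto_qPoch {q : ℂ} (hq : ‖q‖ < 1) :
    Tendsto (qPoch q q) atTop (𝓝 (qPochInf q q)) :=
  (multipliable_qPochInf q q hq).hasProd.tendsto_prod_nat

theorem tendsto_inv_qPoch {q : ℂ} (hq : ‖q‖ < 1) :
    Tendsto (fun n => (qPoch q q n)⁻¹) atTop (𝓝 (qPochInf q q)⁻¹) :=
  (tendsto_qPoch hq).inv₀ (qPochInf_self_ne_zero hq)

theorem exists_norm_inv_qPoch_le {q : ℂ} (hq : ‖q‖ < 1) :
    ∃ C : ℝ, 0 < C ∧ ∀ n, ‖(qPoch q q n)⁻¹‖ ≤ C := by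
  obtain ⟨C, hC⟩ := (tendsto_inv_qPoch hq).norm.bddAbove_range
  have h : ∀ n, ‖(qPoch q q n)⁻¹‖ ≤ C := fun n => hC ⟨n, rfl⟩
  refine ⟨C, lt_of_lt_of_le ?_ (h 0), h⟩
  simp [qPoch_zero]

end QPochhammer

/-! ### Durfee rectangle expansion of `1 / (q; q)_∞`. -/

section Durfee

theorem norm_pow_le_pow {q : ℂ} (hq : ‖q‖ < 1) {m n : ℕ} (h : m ≤ n) : ‖q ^ n‖ ≤ ‖q‖ ^ m := by
  rw [norm_pow]; exact pow_le_pow_of_le_one (norm_nonneg q) hq.le h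

/-- The `s`-th term of the Durfee rectangle expansion of `1 / (q; q)_∞`. -/
noncomputable def durfeeTerm (q : ℂ) (N s : ℕ) : ℂ :=
  q ^ (s ^ 2 + N * s) * (qPoch q q s)⁻¹ * (qPoch q q (s + N))⁻¹

theorem norm_durfeeTerm_le {q : ℂ} (hq : ‖q‖ < 1) {C : ℝ} (hC : ∀ n, ‖(qPoch q q n)⁻¹‖ ≤ C)
    (N s : ℕ) : ‖durfeeTerm q N s‖ ≤ ‖q‖ ^ s * C * C := by
  have hC0 : 0 ≤ C := (norm_nonneg _).trans (hC 0)
  rw [durfeeTerm, norm_mul, norm_mul]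
  gcongr
  · exact norm_pow_le_pow hq (by nlinarith [Nat.zero_le (N * s), Nat.le_self_pow two_ne_zero s])
  · exact hC _
  · exact hC _

theorem summable_durfeeTerm {q : ℂ} (hq : ‖q‖ < 1) (N : ℕ) : Summable (durfeeTerm q N) := by
  obtain ⟨C, -, hC⟩ := exists_norm_inv_qPoch_le hq
  exact .of_norm_bounded
    (((summable_geometric_of_lt_one (norm_nonneg q) hq).mul_right C).mul_right C)
    (norm_durfeeTerm_le hq hC N)

/-- Split each term by `1 = q^s + (1 - q^s)` and shift the second piece by one, where `1 - q^s`
cancels the last factor of `(q)_s`. The two pieces then recombine termwise. -/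
theorem tsum_durfeeTerm_succ {q : ℂ} (hq : ‖q‖ < 1) (N : ℕ) :
    ∑' s, durfeeTerm q N s = ∑' s, durfeeTerm q (N + 1) s := by
  obtain ⟨C, hC0, hC⟩ := exists_norm_inv_qPoch_le hq
  have hgeo := ((summable_geometric_of_lt_one (norm_nonneg q) hq).mul_right C).mul_right C
  let f : ℕ → ℂ := fun s => q ^ s * durfeeTerm q N s
  let g : ℕ → ℂ := fun s => (1 - q ^ s) * durfeeTerm q N s
  have hf : Summable f := by
    refine .of_norm_bounded hgeo fun s => ?_
    refine le_trans ?_ (norm_durfeeTerm_le hq hC N s)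
    rw [norm_mul]
    refine mul_le_of_le_one_left (norm_nonneg _) ?_
    simpa using norm_pow_le_pow hq (Nat.zero_le s)
  have hg : Summable g := by
    refine ((summable_durfeeTerm hq N).sub hf).congr fun s => ?_
    simp only [f, g]; ring
  have h1 : ∑' s, durfeeTerm q N s = ∑' s, f s + ∑' s, g s := by
    rw [← hf.tsum_add hg]
    exact tsum_congr fun s => by simp only [f, g]; ring
  have h2 : ∑' s, g s = ∑' s, g (s + 1) := by
    rw [hg.tsum_eq_zero_add]; simp [g]
  rw [h1, h2, ← hf.tsum_add ((summable_nat_add_iff 1).mpr hg)]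
  refine tsum_congr fun s => ?_
  have e1 : (qPoch q q (s + N))⁻¹ = _ := inv_qPoch_self_eq hq (s + N)
  have e2 : (qPoch q q s)⁻¹ = _ := inv_qPoch_self_eq hq s
  simp only [f, g, durfeeTerm]
  rw [e1, show s + 1 + N = s + N + 1 by ring, show s + (N + 1) = s + N + 1 by ring, e2]
  ring

/-- The sum does not depend on `N`; as `N → ∞` only `s = 0` survives, by dominated convergence. -/
theorem hasSum_durfeeTerm {q : ℂ} (hq : ‖q‖ < 1) (N : ℕ) :
    HasSum (durfeeTerm q N) (qPochInf q q)⁻¹ := by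
  obtain ⟨C, hC0, hC⟩ := exists_norm_inv_qPoch_le hq
  have hconst : ∀ M, ∑' s, durfeeTerm q (N + M) s = ∑' s, durfeeTerm q N s := by
    intro M
    induction M with
    | zero => rfl
    | succ M ih => rw [← add_assoc, ← tsum_durfeeTerm_succ hq, ih]
  have hlim : Tendsto (fun M => ∑' s, durfeeTerm q (N + M) s) atTop
      (𝓝 (∑' s, if s = 0 then (qPochInf q q)⁻¹ else 0)) := by
    refine tendsto_tsum_of_dominated_convergence
      (((summable_geometric_of_lt_one (norm_nonneg q) hq).mul_right C).mul_right C) ?_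
      (.of_forall fun M s => norm_durfeeTerm_le hq hC _ s)
    intro s
    have hshift : Tendsto (fun M => s + (N + M)) atTop atTop :=
      tendsto_atTop_mono (fun M => by simp only [id]; omega) tendsto_id
    have hP := (tendsto_inv_qPoch hq).comp hshift
    by_cases hs : s = 0
    · subst hs
      simpa [durfeeTerm, qPoch_zero, Function.comp_def] using hP
    · have hexp : Tendsto (fun M => s ^ 2 + (N + M) * s) atTop atTop := by
        refine tendsto_atTop_mono (fun M => ?_) tendsto_id
        have := Nat.pos_of_ne_zero hs
        simp only [id]
        nlinarith [Nat.zero_le (s ^ 2), Nat.zero_le N]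
      have hz := (tendsto_pow_atTop_nhds_zero_of_norm_lt_one hq).comp hexp
      have := (hz.mul_const (qPoch q q s)⁻¹).mul hP
      simpa [durfeeTerm, hs, Function.comp_def] using this
  simp only [hconst, tsum_ite_eq] at hlim
  rw [← tendsto_nhds_unique tendsto_const_nhds hlim]
  exact (summable_durfeeTerm hq N).hasSum

end Durfee

/-! ### The Bailey pair, and Gauss's theta evaluation. -/

section BaileyPair

/-- `1 / ((q)_{n-r} (q)_{n+r})`, read as `0` for `r > n`. -/
noncomputable def baileyKernel (q : ℂ) (n r : ℕ) : ℂ :=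
  if r ≤ n then (qPoch q q (n - r))⁻¹ * (qPoch q q (n + r))⁻¹ else 0

/-- `1 / ((q)_{n-r} (q)_{n+r+1})`, read as `0` for `r > n`. -/
noncomputable def baileyKernelOdd (q : ℂ) (n r : ℕ) : ℂ :=
  if r ≤ n then (qPoch q q (n - r))⁻¹ * (qPoch q q (n + r + 1))⁻¹ else 0

theorem baileyKernel_add (q : ℂ) (r s : ℕ) :
    baileyKernel q (r + s) r = (qPoch q q s)⁻¹ * (qPoch q q (s + 2 * r))⁻¹ := by
  rw [baileyKernel, if_pos (by omega), show r + s - r = s by omega,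
    show r + s + r = s + 2 * r by ring]

theorem baileyKernelOdd_add (q : ℂ) (r s : ℕ) :
    baileyKernelOdd q (r + s) r = (qPoch q q s)⁻¹ * (qPoch q q (s + 2 * r + 1))⁻¹ := by
  rw [baileyKernelOdd, if_pos (by omega), show r + s - r = s by omega,
    show r + s + r + 1 = s + 2 * r + 1 by ring]

theorem baileyKernel_of_lt (q : ℂ) {n r : ℕ} (h : n < r) : baileyKernel q n r = 0 :=
  if_neg (by omega)

theorem baileyKernelOdd_of_lt (q : ℂ) {n r : ℕ} (h : n < r) : baileyKernelOdd q n r = 0 :=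
  if_neg (by omega)

/-- Links the Bailey kernels relative to `a = 1` and (up to normalisation) `a = q`, so that the
recurrence for `baileyBeta` becomes a summation by parts in `r`. -/
theorem baileyKernel_add_succ {q : ℂ} (hq : ‖q‖ < 1) (n r : ℕ) :
    baileyKernel q n (r + 1) + (1 - q ^ (2 * n + 2)) * baileyKernel q (n + 1) (r + 1)
      = baileyKernelOdd q n (r + 1) + baileyKernelOdd q n r := by
  rcases lt_trichotomy n r with h | rfl | h
  · rw [baileyKernel_of_lt q (by omega), baileyKernel_of_lt q (by omega),
      baileyKernelOdd_of_lt q (by omega), baileyKernelOdd_of_lt q (by omega)]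
    ring
  · have e := baileyKernel_add q (n + 1) 0
    have e' := baileyKernelOdd_add q n 0
    simp only [add_zero] at e e'
    rw [baileyKernel_of_lt q (by omega), baileyKernelOdd_of_lt q (by omega), e, e',
      show 0 + 2 * (n + 1) = 2 * n + 1 + 1 by ring, show 0 + 2 * n + 1 = 2 * n + 1 by ring,
      inv_qPoch_self_eq hq (2 * n + 1)]
    ring
  · obtain ⟨s, rfl⟩ : ∃ s, n = r + 1 + s := ⟨n - (r + 1), by omega⟩
    have e1 := baileyKernel_add q (r + 1) s
    have e2 := baileyKernel_add q (r + 1) (s + 1)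
    have e3 := baileyKernelOdd_add q (r + 1) s
    have e4 := baileyKernelOdd_add q r (s + 1)
    rw [show r + (s + 1) = r + 1 + s by ring] at e4
    rw [show r + 1 + (s + 1) = r + 1 + s + 1 by ring] at e2
    rw [e1, e2, e3, e4, inv_qPoch_self_eq hq s,
      show s + 2 * (r + 1) = s + 2 * r + 2 by ring,
      show s + 1 + 2 * (r + 1) = s + 2 * r + 2 + 1 by ring,
      show s + 1 + 2 * r + 1 = s + 2 * r + 2 by ring, inv_qPoch_self_eq hq (s + 2 * r + 2)]
    ring

/-- Each summand is a difference of consecutive values of `q^{r²} / ((q)_{n-r} (q)_{n+r})`, so only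
`r = 0` is left. -/
theorem sum_sub_mul_baileyKernelOdd {q : ℂ} (hq : ‖q‖ < 1) (n : ℕ) :
    ∑ r ∈ range (n + 1), (q ^ r ^ 2 - q ^ (r + 1) ^ 2) * baileyKernelOdd q n r
      = (qPoch q q n)⁻¹ ^ 2 := by
  have key : ∀ r ∈ range (n + 1), (q ^ r ^ 2 - q ^ (r + 1) ^ 2) * baileyKernelOdd q n r
      = q ^ r ^ 2 * baileyKernel q n r - q ^ (r + 1) ^ 2 * baileyKernel q n (r + 1) := by
    intro r hr
    rcases (Nat.lt_succ_iff.mp (mem_range.mp hr)).eq_or_lt with rfl | h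
    · have e := baileyKernel_add q r 0
      have e' := baileyKernelOdd_add q r 0
      simp only [add_zero, zero_add] at e e'
      rw [baileyKernel_of_lt q (Nat.lt_succ_self r), e, e', inv_qPoch_self_eq hq (2 * r)]
      ring
    · obtain ⟨s, rfl⟩ : ∃ s, n = r + 1 + s := ⟨n - (r + 1), by omega⟩
      have e1 := baileyKernel_add q (r + 1) s
      have e2 := baileyKernel_add q r (s + 1)
      have e4 := baileyKernelOdd_add q r (s + 1)
      rw [show r + (s + 1) = r + 1 + s by ring] at e4 e2
      rw [e1, e2, e4, inv_qPoch_self_eq hq s,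
        show s + 2 * (r + 1) = s + 2 * r + 1 + 1 by ring,
        show s + 1 + 2 * r + 1 = s + 2 * r + 1 + 1 by ring,
        show s + 1 + 2 * r = s + 2 * r + 1 by ring, inv_qPoch_self_eq hq (s + 2 * r + 1)]
      ring
  rw [sum_congr rfl key, sum_range_sub', baileyKernel_of_lt q (Nat.lt_succ_self n)]
  simp [baileyKernel, sq]

/-- The partial sums `1 + 2 ∑_{1 ≤ j ≤ r} (-1)^j q^{j²}` of the theta series. -/
noncomputable def thetaPartial (q : ℂ) (r : ℕ) : ℂ :=
  1 + 2 * ∑ j ∈ range r, (-1) ^ (j + 1) * q ^ (j + 1) ^ 2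

theorem thetaPartial_succ (q : ℂ) (r : ℕ) :
    thetaPartial q (r + 1) = thetaPartial q r + 2 * ((-1) ^ (r + 1) * q ^ (r + 1) ^ 2) := by
  rw [thetaPartial, thetaPartial, sum_range_succ]; ring

/-- The sequence which, with index shifted by one, forms a Bailey pair with the alternating partial
sums of `(-q; q)_n / (q; q)_n`, divided by `(q²; q²)_n`. -/
noncomputable def baileyAlpha (q : ℂ) (r : ℕ) : ℂ :=
  (-1) ^ r * (thetaPartial q (r + 1) + thetaPartial q r) / 2

theorem baileyAlpha_zero (q : ℂ) : baileyAlpha q 0 = 1 - q := by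
  simp [baileyAlpha, thetaPartial]; ring

theorem baileyAlpha_add_succ (q : ℂ) (r : ℕ) :
    baileyAlpha q r + baileyAlpha q (r + 1) = q ^ (r + 1) ^ 2 - q ^ (r + 2) ^ 2 := by
  have h : ((-1 : ℂ) ^ r) ^ 2 = 1 := by rw [← pow_mul, mul_comm, pow_mul]; simp
  rw [baileyAlpha, baileyAlpha, thetaPartial_succ q (r + 1), thetaPartial_succ q r]
  linear_combination (q ^ (r + 1) ^ 2 - q ^ (r + 2) ^ 2) * h

/-- A difference of squares: up to sign, `q^{(r+1)²}` is half the increment of `thetaPartial` and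
`baileyAlpha` is half the sum of the same two values. -/
theorem baileyAlpha_mul_pow (q : ℂ) (r : ℕ) :
    baileyAlpha q r * q ^ (r + 1) ^ 2
      = thetaPartial q r ^ 2 / 4 - thetaPartial q (r + 1) ^ 2 / 4 := by
  have h : ((-1 : ℂ) ^ r) ^ 2 = 1 := by rw [← pow_mul, mul_comm, pow_mul]; simp
  have h2 : 2 * q ^ (r + 1) ^ 2 = -(-1) ^ r * (thetaPartial q (r + 1) - thetaPartial q r) := by
    rw [thetaPartial_succ]
    linear_combination (-2 * q ^ (r + 1) ^ 2) * h
  rw [baileyAlpha]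
  linear_combination ((-1) ^ r * (thetaPartial q (r + 1) + thetaPartial q r) / 4) * h2
    - ((thetaPartial q (r + 1) ^ 2 - thetaPartial q r ^ 2) / 4) * h

/-- The beta side of the Bailey pair of `baileyAlpha`. -/
noncomputable def baileyBeta (q : ℂ) (n : ℕ) : ℂ :=
  ∑ r ∈ range n, baileyAlpha q r * baileyKernel q n (r + 1)

/-- The kernel relation moves everything to the odd kernel, where the coefficients become `α_r +
α_{r+1}`, with the boundary term `α_0 = 1 - q`. These are the coefficients of the telescoping sum
above. -/
theorem baileyBeta_add_succ {q : ℂ} (hq : ‖q‖ < 1) (n : ℕ) :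
    baileyBeta q n + (1 - q ^ (2 * n + 2)) * baileyBeta q (n + 1) = (qPoch q q n)⁻¹ ^ 2 := by
  have h1 : baileyBeta q n
      = ∑ r ∈ range (n + 1), baileyAlpha q r * baileyKernel q n (r + 1) := by
    rw [sum_range_succ, baileyKernel_of_lt q (Nat.lt_succ_self n), mul_zero, add_zero, baileyBeta]
  have h2 : ∑ r ∈ range (n + 1), baileyAlpha q r * baileyKernelOdd q n (r + 1)
      = ∑ r ∈ range n, baileyAlpha q r * baileyKernelOdd q n (r + 1) := by
    rw [sum_range_succ, baileyKernelOdd_of_lt q (Nat.lt_succ_self n), mul_zero, add_zero]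
  rw [← sum_sub_mul_baileyKernelOdd hq n, sum_range_succ', h1, baileyBeta, mul_sum,
    ← sum_add_distrib]
  have h3 : ∀ r ∈ range (n + 1), baileyAlpha q r * baileyKernel q n (r + 1)
      + (1 - q ^ (2 * n + 2)) * (baileyAlpha q r * baileyKernel q (n + 1) (r + 1))
      = baileyAlpha q r * baileyKernelOdd q n (r + 1)
        + baileyAlpha q r * baileyKernelOdd q n r := by
    intro r _
    rw [← mul_add, ← baileyKernel_add_succ hq]; ring
  rw [sum_congr rfl h3, sum_add_distrib, h2, sum_range_succ' _ n, ← add_assoc, ← sum_add_distrib,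
    baileyAlpha_zero]
  congr 1
  · refine sum_congr rfl fun r _ => ?_
    rw [← baileyAlpha_add_succ]; ring
  · simp

/-- A finite form of Gauss's evaluation of `∑ (-1)^r q^{r²}`. -/
theorem sum_neg_one_pow_mul_baileyKernel {q : ℂ} (hq : ‖q‖ < 1) (n : ℕ) :
    baileyKernel q n 0
        + 2 * ∑ r ∈ range n, (-1) ^ (r + 1) * q ^ (r + 1) ^ 2 * baileyKernel q n (r + 1)
      = (qPoch (q ^ 2) (q ^ 2) n)⁻¹ := by
  induction n with
  | zero => simp [baileyKernel, qPoch_zero]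
  | succ n ih =>
    have hne := one_sub_pow_succ_ne_zero (norm_sq_lt_one hq) n
    rw [qPoch_self_succ, mul_inv, ← ih, eq_mul_inv_iff_mul_eq₀ hne, ← pow_mul]
    -- Telescoping certificate: the defect of the recurrence in `n` is, term by term in `r`, a
    -- difference of `H`.
    let H : ℕ → ℂ := fun r => if r ≤ n + 1 then (-1) ^ r * q ^ (r ^ 2 - r + n + 1)
      * ((qPoch q q (n + 1 - r))⁻¹ * (qPoch q q (n + r))⁻¹) else 0
    have key : ∀ r, (-1) ^ r * q ^ r ^ 2 * baileyKernel q (n + 1) r * (1 - q ^ (2 * (n + 1)))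
        - (-1) ^ r * q ^ r ^ 2 * baileyKernel q n r = H r - H (r + 1) := by
      intro r
      rcases lt_trichotomy r (n + 1) with h | rfl | h
      · obtain ⟨s, rfl⟩ : ∃ s, n = r + s := ⟨n - r, by omega⟩
        have e1 := baileyKernel_add q r s
        have e2 := baileyKernel_add q r (s + 1)
        rw [← add_assoc] at e2
        have hr : r ≤ r ^ 2 := Nat.le_self_pow two_ne_zero r
        obtain ⟨t, ht⟩ := Nat.exists_eq_add_of_le hr
        simp only [H]
        rw [e1, e2, if_pos (by omega), if_pos (by omega),
          show r + s + 1 - r = s + 1 by omega, show r + s + 1 - (r + 1) = s by omega,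
          show r + s + r = s + 2 * r by ring, show r + s + (r + 1) = s + 2 * r + 1 by ring,
          show r ^ 2 - r + (r + s) + 1 = r ^ 2 + s + 1 by omega,
          show (r + 1) ^ 2 - (r + 1) + (r + s) + 1 = r ^ 2 + 2 * r + s + 1 by
            rw [show (r + 1) ^ 2 = r ^ 2 + r + (r + 1) by ring]; omega,
          show s + 1 + 2 * r = s + 2 * r + 1 by ring,
          inv_qPoch_self_eq hq s, inv_qPoch_self_eq hq (s + 2 * r)]
        ring
      · have e := baileyKernel_add q (n + 1) 0
        simp only [add_zero, zero_add] at e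
        simp only [H]
        rw [e, baileyKernel_of_lt q (Nat.lt_succ_self n), if_pos le_rfl, if_neg (by omega),
          show n + (n + 1) = 2 * n + 1 by ring, inv_qPoch_self_eq hq (2 * n + 1), Nat.sub_self,
          show (n + 1) ^ 2 - (n + 1) + n + 1 = (n + 1) ^ 2 by
            have : n + 1 ≤ (n + 1) ^ 2 := Nat.le_self_pow two_ne_zero _
            omega, show 2 * (n + 1) = 2 * n + 1 + 1 by ring]
        ring
      · simp only [H]
        rw [baileyKernel_of_lt q h, baileyKernel_of_lt q (by omega), if_neg (by omega),
          if_neg (by omega)]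
        ring
    have hsum := sum_range_sub' (fun r => H (r + 1)) (n + 1)
    have hlast : H (n + 1 + 1) = 0 := if_neg (by omega)
    -- `H` is formally odd under `r ↦ 1 - r`; this cancels the boundary terms left by folding the
    -- sum over `ℤ` onto `r ≥ 0`.
    have h01 : H 0 + H 1 = 0 := by
      simp only [H]
      rw [if_pos (by omega), if_pos (by omega)]
      simp; ring
    rw [← sum_congr rfl fun r _ => key (r + 1), sum_sub_distrib, ← sum_mul] at hsum
    have hcut : ∑ r ∈ range (n + 1), (-1) ^ (r + 1) * q ^ (r + 1) ^ 2 * baileyKernel q n (r + 1)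
        = ∑ r ∈ range n, (-1) ^ (r + 1) * q ^ (r + 1) ^ 2 * baileyKernel q n (r + 1) := by
      rw [sum_range_succ, baileyKernel_of_lt q (Nat.lt_succ_self n), mul_zero, add_zero]
    rw [hcut] at hsum
    have k0 := key 0
    simp only [pow_zero, one_mul, zero_add, ne_eq, OfNat.ofNat_ne_zero, not_false_eq_true,
      zero_pow, hlast] at k0 hsum
    linear_combination 2 * hsum + k0 + h01

theorem summable_theta {q : ℂ} (hq : ‖q‖ < 1) :
    Summable fun j : ℕ => (-1) ^ (j + 1) * q ^ (j + 1) ^ 2 := by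
  refine .of_norm_bounded (summable_geometric_of_lt_one (norm_nonneg q) hq) fun j => ?_
  rw [norm_mul, norm_pow, norm_neg, norm_one, one_pow, one_mul]
  exact norm_pow_le_pow hq (by nlinarith)

/-- Gauss: `∑_{r ∈ ℤ} (-1)^r q^{r²} = (q; q)_∞² / (q²; q²)_∞`. -/
theorem tendsto_thetaPartial {q : ℂ} (hq : ‖q‖ < 1) :
    Tendsto (thetaPartial q) atTop (𝓝 (qPochInf q q ^ 2 / qPochInf (q ^ 2) (q ^ 2))) := by
  obtain ⟨C, hC0, hC⟩ := exists_norm_inv_qPoch_le hq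
  have hthm : Tendsto (thetaPartial q) atTop
      (𝓝 (1 + 2 * ∑' j : ℕ, (-1) ^ (j + 1) * q ^ (j + 1) ^ 2)) :=
    ((summable_theta hq).hasSum.tendsto_sum_nat.const_mul 2).const_add 1
  have hker : ∀ r, Tendsto (fun n => baileyKernel q n r) atTop
      (𝓝 ((qPochInf q q)⁻¹ * (qPochInf q q)⁻¹)) := by
    intro r
    have h1 := (tendsto_inv_qPoch hq).comp (tendsto_sub_atTop_nat r)
    have h2 := (tendsto_inv_qPoch hq).comp (tendsto_add_atTop_nat r)
    refine (h1.mul h2).congr' ?_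
    filter_upwards [eventually_ge_atTop r] with n hn
    simp [baileyKernel, hn]
  -- Let `n → ∞` in the finite identity; the kernel tends to `1 / (q; q)_∞²` for each fixed `r`.
  have hlim : Tendsto (fun n => baileyKernel q n 0
        + 2 * ∑' r, (-1) ^ (r + 1) * q ^ (r + 1) ^ 2 * baileyKernel q n (r + 1)) atTop
      (𝓝 ((qPochInf q q)⁻¹ * (qPochInf q q)⁻¹ + 2 * ∑' r : ℕ, (-1) ^ (r + 1) * q ^ (r + 1) ^ 2
        * ((qPochInf q q)⁻¹ * (qPochInf q q)⁻¹))) := by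
    refine (hker 0).add (Tendsto.const_mul 2 ?_)
    refine tendsto_tsum_of_dominated_convergence (bound := fun r => ‖q‖ ^ r * (C * C))
      ((summable_geometric_of_lt_one (norm_nonneg q) hq).mul_right _)
      (fun r => (hker (r + 1)).const_mul _) (.of_forall fun n r => ?_)
    rw [norm_mul, norm_mul, norm_pow, norm_neg, norm_one, one_pow, one_mul]
    gcongr
    · exact norm_pow_le_pow hq (by nlinarith)
    · rw [baileyKernel]
      split_ifs
      · rw [norm_mul]
        gcongr
        · exact hC _
        · exact hC _
      · rw [norm_zero]; positivity
  have hfin : ∀ n, baileyKernel q n 0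
        + 2 * ∑' r, (-1) ^ (r + 1) * q ^ (r + 1) ^ 2 * baileyKernel q n (r + 1)
      = (qPoch (q ^ 2) (q ^ 2) n)⁻¹ := by
    intro n
    rw [tsum_eq_sum (s := range n), sum_neg_one_pow_mul_baileyKernel hq]
    intro r hr
    rw [baileyKernel_of_lt q (by simpa using hr), mul_zero]
  simp only [hfin] at hlim
  have h := tendsto_nhds_unique hlim (tendsto_inv_qPoch (norm_sq_lt_one hq))
  rw [tsum_mul_right] at h
  convert hthm using 2
  rw [div_eq_mul_inv, ← h]
  have := qPochInf_self_ne_zero hq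
  field_simp

end BaileyPair

/-! ### The limiting Bailey lemma for this pair. -/

section BaileyLemma

theorem hasSum_sum_antidiagonal {F : ℕ × ℕ → ℂ} {a : ℂ} (h : HasSum F a) :
    HasSum (fun n => ∑ p ∈ antidiagonal n, F p) a := by
  have h1 := (Finset.HasAntidiagonal.sigmaAntidiagonalEquivProd.hasSum_iff).mpr h
  refine h1.sigma fun n => ?_
  have := hasSum_fintype (fun p : antidiagonal n => F p.1)
  rwa [Finset.sum_coe_sort (antidiagonal n) F] at this

theorem exists_norm_baileyAlpha_le {q : ℂ} (hq : ‖q‖ < 1) :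
    ∃ C : ℝ, 0 ≤ C ∧ ∀ r, ‖baileyAlpha q r‖ ≤ C := by
  obtain ⟨C, hC⟩ := (tendsto_thetaPartial hq).norm.bddAbove_range
  have h : ∀ n, ‖thetaPartial q n‖ ≤ C := fun n => hC ⟨n, rfl⟩
  refine ⟨C, (norm_nonneg _).trans (h 0), fun r => ?_⟩
  rw [baileyAlpha, norm_div, norm_mul, norm_pow, norm_neg, norm_one, one_pow, one_mul]
  have := norm_add_le (thetaPartial q (r + 1)) (thetaPartial q r)
  have := h r
  have := h (r + 1)
  simp only [RCLike.norm_ofNat]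
  linarith

theorem hasSum_baileyAlpha_mul_pow {q : ℂ} (hq : ‖q‖ < 1) :
    HasSum (fun r => baileyAlpha q r * q ^ (r + 1) ^ 2)
      (1 / 4 - (qPochInf q q ^ 2 / qPochInf (q ^ 2) (q ^ 2)) ^ 2 / 4) := by
  obtain ⟨C, hC0, hC⟩ := exists_norm_baileyAlpha_le hq
  have hs : Summable (fun r => baileyAlpha q r * q ^ (r + 1) ^ 2) := by
    refine .of_norm_bounded
      ((summable_geometric_of_lt_one (norm_nonneg q) hq).mul_left C) fun r => ?_
    rw [norm_mul]
    gcongr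
    · exact hC r
    · exact norm_pow_le_pow hq (by nlinarith)
  rw [hs.hasSum_iff_tendsto_nat]
  simp only [baileyAlpha_mul_pow, sum_range_sub' (fun r => thetaPartial q r ^ 2 / 4)]
  have h0 : thetaPartial q 0 = 1 := by simp [thetaPartial]
  rw [h0, one_pow]
  exact (((tendsto_thetaPartial hq).pow 2).div_const 4).const_sub _

/-- Write `n = r + s` and interchange the sums: for fixed `r`, the sum over `s` is the Durfee
expansion with `N = 2(r+1)`, contributing the common factor `1 / (q; q)_∞`. -/
theorem hasSum_baileyBeta {q : ℂ} (hq : ‖q‖ < 1) :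
    HasSum (fun n => q ^ (n + 1) ^ 2 * baileyBeta q (n + 1))
      ((1 / 4 - (qPochInf q q ^ 2 / qPochInf (q ^ 2) (q ^ 2)) ^ 2 / 4) * (qPochInf q q)⁻¹) := by
  obtain ⟨C, hC0, hC⟩ := exists_norm_inv_qPoch_le hq
  obtain ⟨A, hA0, hA⟩ := exists_norm_baileyAlpha_le hq
  let F : ℕ × ℕ → ℂ := fun p => baileyAlpha q p.1 * q ^ (p.1 + 1) ^ 2
    * durfeeTerm q (2 * (p.1 + 1)) p.2
  have hgeo := summable_geometric_of_lt_one (norm_nonneg q) hq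
  have hF : Summable F := by
    have hb : Summable fun p : ℕ × ℕ => (A * ‖q‖ ^ p.1) * (‖q‖ ^ p.2 * C * C) :=
      (hgeo.mul_left A).mul_of_nonneg ((hgeo.mul_right C).mul_right C)
        (fun _ => by positivity) (fun _ => by positivity)
    refine .of_norm_bounded hb fun p => ?_
    rw [norm_mul, norm_mul]
    gcongr
    · exact hA _
    · exact norm_pow_le_pow hq (by nlinarith)
    · exact norm_durfeeTerm_le hq hC _ _
  have hrow := hF.hasSum.prod_fiberwise fun r =>
    (hasSum_durfeeTerm hq (2 * (r + 1))).mul_left (baileyAlpha q r * q ^ (r + 1) ^ 2)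
  have hval := hrow.unique ((hasSum_baileyAlpha_mul_pow hq).mul_right _)
  have := hasSum_sum_antidiagonal hF.hasSum
  rw [hval] at this
  convert this using 2 with n
  rw [Finset.Nat.sum_antidiagonal_eq_sum_range_succ_mk, baileyBeta, mul_sum]
  refine sum_congr rfl fun r hr => ?_
  obtain ⟨s, rfl⟩ : ∃ s, n = r + s := ⟨n - r, by have := mem_range.mp hr; omega⟩
  have e := baileyKernel_add q (r + 1) s
  rw [show r + s + 1 = r + 1 + s by ring, e, show r + s - r = s by omega]
  simp only [F, durfeeTerm]
  ring

end BaileyLemma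

/-! ### Generating functions and their q-difference equations. -/

section GeneratingFunctions

open PowerSeries

theorem rescale_C (r a : ℂ) : rescale r (C a) = C a := by
  ext n
  rw [coeff_rescale, coeff_C]
  split_ifs with h <;> simp [h]

theorem coeff_mul_of_coeff_eq_zero {Q H : PowerSeries ℂ} {n : ℕ} (hQ : coeff 0 Q = 1)
    (h : ∀ m < n, coeff m H = 0) : coeff n (Q * H) = coeff n H := by
  rw [coeff_mul, sum_eq_single (0, n)]
  · rw [hQ, one_mul]
  · rintro ⟨i, j⟩ hij hne
    have hij' : i + j = n := mem_antidiagonal.mp hij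
    have : i ≠ 0 := fun h0 => hne (by ext <;> simp only <;> omega)
    rw [h j (by omega), mul_zero]
  · simp

/-- A power series satisfying a first order `r`-difference equation is determined by its constant
coefficient. -/
theorem eq_of_rescale_eq {F G P Q : PowerSeries ℂ} {r : ℂ} (hr : ‖r‖ < 1) (hP : coeff 0 P = 1)
    (hQ : coeff 0 Q = 1) (h0 : coeff 0 F = coeff 0 G) (hF : Q * F = P * rescale r F)
    (hG : Q * G = P * rescale r G) : F = G := by
  rw [← sub_eq_zero]
  have hH : Q * (F - G) = P * rescale r (F - G) := by rw [mul_sub, map_sub, mul_sub, hF, hG]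
  ext n
  rw [map_zero]
  induction n using Nat.strong_induction_on with
  | _ n ih =>
    cases n with
    | zero => rw [map_sub, h0, sub_self]
    | succ n =>
      have h1 := congrArg (coeff (n + 1)) hH
      rw [coeff_mul_of_coeff_eq_zero hQ ih, coeff_mul_of_coeff_eq_zero hP
        (fun m hm => by rw [coeff_rescale, ih m hm, mul_zero]), coeff_rescale] at h1
      have h2 : (1 - r ^ (n + 1)) * coeff (n + 1) (F - G) = 0 := by linear_combination h1
      exact (mul_eq_zero.mp h2).resolve_left (one_sub_pow_succ_ne_zero hr n)

/-- `∑ q^{i(i+1)/2} z^i / (q; q)_i = (-zq; q)_∞`. -/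
noncomputable def genA (q : ℂ) : PowerSeries ℂ :=
  .mk fun i => q ^ ((i ^ 2 + i) / 2) * (qPoch q q i)⁻¹

/-- `∑ q^{j² + j} z^j / (q²; q²)_j = (-zq²; q²)_∞`. -/
noncomputable def genB (q : ℂ) : PowerSeries ℂ :=
  .mk fun j => q ^ (j ^ 2 + j) * (qPoch (q ^ 2) (q ^ 2) j)⁻¹

/-- `∑ z^{2k} / (q²; q²)_k = 1 / (z²; q²)_∞`. -/
noncomputable def genK (q : ℂ) : PowerSeries ℂ :=
  .mk fun l => if Even l then (qPoch (q ^ 2) (q ^ 2) (l / 2))⁻¹ else 0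

/-- `∑ q^{s²} z^s / (q²; q²)_s = (-zq; q²)_∞`. -/
noncomputable def genD (q : ℂ) : PowerSeries ℂ :=
  .mk fun s => q ^ s ^ 2 * (qPoch (q ^ 2) (q ^ 2) s)⁻¹

/-- `∑ (-q; q)_n z^n / (q; q)_n = (-zq; q)_∞ / (z; q)_∞`. -/
noncomputable def genM (q : ℂ) : PowerSeries ℂ :=
  .mk fun n => qPoch (-q) q n * (qPoch q q n)⁻¹

theorem triangle_succ (i : ℕ) : ((i + 1) ^ 2 + (i + 1)) / 2 = (i ^ 2 + i) / 2 + (i + 1) := by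
  rw [show (i + 1) ^ 2 + (i + 1) = i ^ 2 + i + (i + 1) * 2 by ring,
    Nat.add_mul_div_right _ _ two_pos]

theorem genA_eq {q : ℂ} (hq : ‖q‖ < 1) :
    genA q = (1 + C q * X) * rescale q (genA q) := by
  ext n
  cases n with
  | zero => simp [genA, add_mul, mul_assoc, rescale_mk]
  | succ n =>
    rw [add_mul, one_mul, mul_assoc, map_add, coeff_C_mul, coeff_succ_X_mul]
    simp only [coeff_rescale, genA, coeff_mk]
    rw [inv_qPoch_self_eq hq n, triangle_succ]
    ring

theorem genB_eq {q : ℂ} (hq : ‖q‖ < 1) :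
    genB q = (1 + C (q ^ 2) * X) * rescale (q ^ 2) (genB q) := by
  ext n
  cases n with
  | zero => simp [genB, add_mul, mul_assoc, rescale_mk]
  | succ n =>
    rw [add_mul, one_mul, mul_assoc, map_add, coeff_C_mul, coeff_succ_X_mul]
    simp only [coeff_rescale, genB, coeff_mk]
    rw [inv_qPoch_self_eq (norm_sq_lt_one hq) n]
    ring

theorem genD_eq {q : ℂ} (hq : ‖q‖ < 1) :
    genD q = (1 + C q * X) * rescale (q ^ 2) (genD q) := by
  ext n
  cases n with
  | zero => simp [genD, add_mul, mul_assoc, rescale_mk]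
  | succ n =>
    rw [add_mul, one_mul, mul_assoc, map_add, coeff_C_mul, coeff_succ_X_mul]
    simp only [coeff_rescale, genD, coeff_mk]
    rw [inv_qPoch_self_eq (norm_sq_lt_one hq) n]
    ring

theorem genK_eq {q : ℂ} (hq : ‖q‖ < 1) :
    (1 - X ^ 2) * genK q = rescale q (genK q) := by
  ext n
  rw [sub_mul, one_mul, map_sub, coeff_rescale, coeff_X_pow_mul', genK, coeff_mk]
  rcases Nat.even_or_odd' n with ⟨m, rfl | rfl⟩
  · cases m with
    | zero => simp
    | succ m =>
      rw [if_pos (by simp), if_pos (by omega), coeff_mk, show 2 * (m + 1) - 2 = 2 * m by omega,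
        if_pos (by simp), Nat.mul_div_cancel_left _ two_pos, Nat.mul_div_cancel_left _ two_pos,
        inv_qPoch_self_eq (norm_sq_lt_one hq) m]
      ring
  · rw [if_neg (by simp), coeff_mk]
    split_ifs with h1 h2
    · exact absurd h2 (by rw [Nat.not_even_iff_odd]; exact ⟨m - 1, by omega⟩)
    · simp
    · simp

/-- Even and odd factors of `(-zq; q)_∞`. Iterating the equation of `genA` twice gives the
`q²`-difference equation of the product. -/
theorem genB_mul_genD {q : ℂ} (hq : ‖q‖ < 1) : genB q * genD q = genA q := by
  refine eq_of_rescale_eq (P := (1 + C q * X) * (1 + C (q ^ 2) * X)) (Q := 1) (norm_sq_lt_one hq)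
    (by simp) (by simp) (by simp [genA, genB, genD, qPoch_zero]) ?_ ?_
  · rw [one_mul, map_mul]
    conv_lhs => rw [genB_eq hq, genD_eq hq]
    ring
  · conv_lhs => rw [genA_eq hq, genA_eq hq]
    rw [map_mul, rescale_rescale, ← sq, map_add, map_mul, map_one, rescale_X, rescale_C, one_mul,
      ← mul_assoc (C q) (C q) X, ← map_mul, ← sq, mul_assoc]

theorem genM_eq {q : ℂ} (hq : ‖q‖ < 1) :
    (1 - X) * genM q = (1 + C q * X) * rescale q (genM q) := by
  ext n
  cases n with
  | zero => simp [genM, qPoch_zero, rescale_mk]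
  | succ n =>
    rw [add_mul, one_mul, sub_mul, one_mul, mul_assoc, map_add, map_sub, coeff_C_mul,
      coeff_succ_X_mul, coeff_succ_X_mul]
    simp only [coeff_rescale, genM, coeff_mk]
    rw [inv_qPoch_self_eq hq n, qPoch_succ]
    ring

/-- Both sides solve `(1 - z) F(z) = (1 + qz) F(qz)`; the factor `1 + z` completes `1 - z` to the `1
- z²` of `genK_eq`. -/
theorem genA_sq_mul_genK {q : ℂ} (hq : ‖q‖ < 1) : (1 + X) * (genA q ^ 2 * genK q) = genM q := by
  refine eq_of_rescale_eq (P := 1 + C q * X) (Q := 1 - X) hq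
    (by simp) (by simp) (by simp [genA, genK, genM, qPoch_zero]) ?_ (genM_eq hq)
  rw [map_mul, map_mul, map_pow, ← genK_eq hq, map_add, map_one, rescale_X]
  conv_lhs => rw [genA_eq hq]
  ring

/-- The coefficients of `(1 + z)⁻¹ (-zq; q)_∞ / (z; q)_∞`. -/
theorem coeff_genA_sq_mul_genK {q : ℂ} (hq : ‖q‖ < 1) (n : ℕ) :
    coeff n (genA q ^ 2 * genK q) = qPoch (q ^ 2) (q ^ 2) (n + 1) * baileyBeta q (n + 1) := by
  have hβ : ∀ m, qPoch (q ^ 2) (q ^ 2) m * baileyBeta q m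
      + qPoch (q ^ 2) (q ^ 2) (m + 1) * baileyBeta q (m + 1)
      = coeff m (genM q) := by
    intro m
    have h := baileyBeta_add_succ hq m
    have hne := qPoch_self_ne_zero hq m
    rw [genM, coeff_mk, qPoch_self_succ, qPoch_sq, ← pow_mul, show 2 * (m + 1) = 2 * m + 2 by ring]
    field_simp at h ⊢
    linear_combination qPoch (-q) q m * h
  induction n with
  | zero =>
    have h := hβ 0
    rw [← genA_sq_mul_genK hq] at h
    simp only [baileyBeta, add_mul, map_add, coeff_zero_X_mul] at h ⊢
    simpa using h.symm
  | succ n ih =>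
    have h := hβ (n + 1)
    rw [← genA_sq_mul_genK hq, add_mul, one_mul, map_add, coeff_succ_X_mul, ih] at h
    linear_combination -h

end GeneratingFunctions

/-! ### Evaluation of the two triple sums. -/

section Evaluation

open PowerSeries

theorem hasSum_of_eq {ι : Type*} {f g : ι → ℂ} {a b : ℂ} (h : HasSum f a) (hfg : ∀ x, g x = f x)
    (hab : b = a) : HasSum g b := by
  rwa [hab, funext hfg]

/-- `G` sees the last two indices only through their sum, so grouping by antidiagonals produces a
Cauchy product coefficient. -/
theorem hasSum_convolution {ι : Type*} {G : ι → ℕ → ℂ} {U V : PowerSeries ℂ} {a : ℂ}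
    (h : HasSum (fun p : ι × ℕ × ℕ => G p.1 (p.2.1 + p.2.2) * (coeff p.2.1 U * coeff p.2.2 V)) a) :
    HasSum (fun p : ι × ℕ => G p.1 p.2 * coeff p.2 (U * V)) a := by
  let e : (Σ p : ι × ℕ, antidiagonal p.2) ≃ ι × ℕ × ℕ :=
    { toFun := fun x => (x.1.1, x.2.1)
      invFun := fun x => ⟨(x.1, x.2.1 + x.2.2), ⟨x.2, by simp⟩⟩
      left_inv := by
        rintro ⟨⟨i, n⟩, ⟨⟨j, k⟩, h⟩⟩
        obtain rfl : j + k = n := by simpa using h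
        rfl
      right_inv := fun _ => rfl }
  have h1 := e.hasSum_iff.mpr h
  refine h1.sigma fun p => ?_
  rw [coeff_mul, mul_sum]
  have := hasSum_fintype (fun x : antidiagonal p.2 =>
    G p.1 p.2 * (coeff x.1.1 U * coeff x.1.2 V))
  rw [Finset.sum_coe_sort (antidiagonal p.2)
    (fun x => G p.1 p.2 * (coeff x.1 U * coeff x.2 V))] at this
  convert this using 2 with x
  have := mem_antidiagonal.mp x.2
  simp [e, this]

theorem hasSum_convolution_four {g : ℕ → ℂ} {U₁ U₂ U₃ U₄ : PowerSeries ℂ} {a : ℂ}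
    (h : HasSum (fun p : ℕ × ℕ × ℕ × ℕ => g (p.1 + (p.2.1 + (p.2.2.1 + p.2.2.2))) *
      (coeff p.1 U₁ * (coeff p.2.1 U₂ * (coeff p.2.2.1 U₃ * coeff p.2.2.2 U₄)))) a) :
    HasSum (fun n => g n * coeff n (U₁ * (U₂ * (U₃ * U₄)))) a := by
  have h1 := (Equiv.prodAssoc ℕ ℕ (ℕ × ℕ)).hasSum_iff.mpr h
  have h2 := hasSum_convolution (U := U₃) (V := U₄)
    (G := fun (x : ℕ × ℕ) n => g (x.1 + (x.2 + n)) * (coeff x.1 U₁ * coeff x.2 U₂)) (a := a)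
    (by convert h1 using 2 with x; simp [mul_assoc])
  have h3 := (Equiv.prodAssoc ℕ ℕ ℕ).symm.hasSum_iff.mpr h2
  have h4 := hasSum_convolution (U := U₂) (V := U₃ * U₄)
    (G := fun (i : ℕ) n => g (i + n) * coeff i U₁) (a := a)
    (by convert h3 using 2 with x; simp [mul_assoc])
  -- A one-point index type lets the same lemma absorb the last remaining factor.
  have h5 := (Equiv.punitProd.{0} (ℕ × ℕ)).hasSum_iff.mpr h4
  have h6 := hasSum_convolution (U := U₁) (V := U₂ * (U₃ * U₄))
    (G := fun (_ : PUnit.{1}) n => g n) (a := a)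
    (by convert h5 using 2 with x; simp [mul_assoc])
  simpa [Function.comp_def] using (Equiv.punitProd.{0} ℕ).symm.hasSum_iff.mpr h6

/-- The part of the summand independent of the square `(i + j + 2k + δ)²` in the exponent. -/
noncomputable def nahmWeight (q : ℂ) (t : ℕ × ℕ × ℕ) : ℂ :=
  (q ^ ((t.1 ^ 2 + t.1) / 2) * (qPoch q q t.1)⁻¹) *
    ((q ^ (t.2.1 ^ 2 + t.2.1) * (qPoch (q ^ 2) (q ^ 2) t.2.1)⁻¹) *
      (qPoch (q ^ 2) (q ^ 2) t.2.2)⁻¹)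

theorem expo₁_eq (i j k : ℕ) :
    expo₁ i j k = (i + j + 2 * k) ^ 2 + ((i ^ 2 + i) / 2 + (j ^ 2 + j)) := by
  rw [expo₁, show 3 * i ^ 2 + i = i ^ 2 + i + i ^ 2 * 2 by ring,
    Nat.add_mul_div_right _ _ two_pos]
  ring

theorem expo₂_add_one (i j k : ℕ) :
    expo₂ i j k + 1 = (i + j + 2 * k + 1) ^ 2 + ((i ^ 2 + i) / 2 + (j ^ 2 + j)) := by
  rw [expo₂, show 3 * i ^ 2 + 5 * i = i ^ 2 + i + (i ^ 2 + 2 * i) * 2 by ring,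
    Nat.add_mul_div_right _ _ two_pos]
  ring

theorem nahmTerm₁_eq (q : ℂ) (t : ℕ × ℕ × ℕ) :
    nahmTerm₁ q t = nahmWeight q t * q ^ (t.1 + t.2.1 + 2 * t.2.2 + 0) ^ 2 := by
  rw [nahmTerm₁, nahmWeight, expo₁_eq, div_eq_mul_inv, mul_inv, mul_inv, add_zero, pow_add,
    pow_add]
  ring

theorem nahmTerm₂_eq {q : ℂ} (hq0 : q ≠ 0) (t : ℕ × ℕ × ℕ) :
    nahmTerm₂ q t = q⁻¹ * (nahmWeight q t * q ^ (t.1 + t.2.1 + 2 * t.2.2 + 1) ^ 2) := by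
  have h : q ^ expo₂ t.1 t.2.1 t.2.2 = q⁻¹ * (q ^ (t.1 + t.2.1 + 2 * t.2.2 + 1) ^ 2
      * (q ^ ((t.1 ^ 2 + t.1) / 2) * q ^ (t.2.1 ^ 2 + t.2.1))) := by
    rw [← pow_add, ← pow_add, ← expo₂_add_one, pow_succ']
    field_simp
  rw [nahmTerm₂, nahmWeight, h, div_eq_mul_inv, mul_inv, mul_inv]
  ring

/-- A quadruple sum is evaluated in two ways. Summing `s` first is Durfee in base `q²`, since
`(N+s)² + s² = N² + 2(s² + Ns)`; grouping by `i+j+2k+s` gives the coefficients of `genA q ^ 2 * genK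
q`. -/
theorem hasSum_nahmWeight {q : ℂ} (hq : ‖q‖ < 1) (δ : ℕ) {a : ℂ}
    (ha : HasSum (fun m => q ^ (m + δ) ^ 2 * (qPoch (q ^ 2) (q ^ 2) (m + δ))⁻¹
      * (qPoch (q ^ 2) (q ^ 2) (m + 1) * baileyBeta q (m + 1))) a) :
    HasSum (fun t : ℕ × ℕ × ℕ => nahmWeight q t * q ^ (t.1 + t.2.1 + 2 * t.2.2 + δ) ^ 2)
      (qPochInf (q ^ 2) (q ^ 2) * a) := by
  obtain ⟨C₁, hC₁0, hC₁⟩ := exists_norm_inv_qPoch_le hq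
  obtain ⟨C, hC0, hC⟩ := exists_norm_inv_qPoch_le (norm_sq_lt_one hq)
  let g : ℕ → ℂ := fun m => q ^ (m + δ) ^ 2 * (qPoch (q ^ 2) (q ^ 2) (m + δ))⁻¹
  let F : (ℕ × ℕ × ℕ) × ℕ → ℂ := fun p =>
    nahmWeight q p.1 * (g (p.1.1 + p.1.2.1 + 2 * p.1.2.2 + p.2) * coeff p.2 (genD q))
  have hgeo := summable_geometric_of_lt_one (norm_nonneg q) hq
  have hF : Summable F := by
    have hb : Summable fun p : (ℕ × ℕ × ℕ) × ℕ =>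
        ((‖q‖ ^ p.1.1 * (‖q‖ ^ p.1.2.1 * ‖q‖ ^ p.1.2.2)) * ‖q‖ ^ p.2)
          * ((C₁ * (C * C)) * (C * C)) := by
      refine Summable.mul_right _ ?_
      have h2 := hgeo.mul_of_nonneg hgeo (fun _ => by positivity) (fun _ => by positivity)
      have h3 := hgeo.mul_of_nonneg h2 (fun _ => by positivity) (fun _ => by positivity)
      exact h3.mul_of_nonneg hgeo (fun _ => by positivity) (fun _ => by positivity)
    refine .of_norm_bounded hb ?_
    rintro ⟨⟨i, j, k⟩, s⟩
    have e1 : ‖F ((i, j, k), s)‖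
        = ‖q ^ ((i ^ 2 + i) / 2 + (j ^ 2 + j) + (i + j + 2 * k + s + δ) ^ 2 + s ^ 2)‖
          * ((‖(qPoch q q i)⁻¹‖ * (‖(qPoch (q ^ 2) (q ^ 2) j)⁻¹‖ * ‖(qPoch (q ^ 2) (q ^ 2) k)⁻¹‖))
          * (‖(qPoch (q ^ 2) (q ^ 2) (i + j + 2 * k + s + δ))⁻¹‖ * ‖(qPoch (q ^ 2) (q ^ 2) s)⁻¹‖)) := by
      simp only [F, g, nahmWeight, genD, coeff_mk, ← norm_mul]
      congr 1
      simp only [pow_add]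
      ring
    rw [e1, ← pow_add, ← pow_add, ← pow_add]
    have b0 : ‖q ^ ((i ^ 2 + i) / 2 + (j ^ 2 + j) + (i + j + 2 * k + s + δ) ^ 2 + s ^ 2)‖
        ≤ ‖q‖ ^ (i + (j + k) + s) := by
      refine norm_pow_le_pow hq ?_
      have : i + j + 2 * k + s + δ ≤ (i + j + 2 * k + s + δ) ^ 2 := Nat.le_self_pow two_ne_zero _
      omega
    have b1 := hC₁ i
    have b2 := hC j
    have b3 := hC k
    have b4 := hC (i + j + 2 * k + s + δ)
    have b5 := hC s
    exact mul_le_mul b0 (mul_le_mul (mul_le_mul b1 (mul_le_mul b2 b3 (norm_nonneg _) hC0.le)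
      (by positivity) hC₁0.le) (mul_le_mul b4 b5 (norm_nonneg _) hC0.le) (by positivity)
      (by positivity)) (by positivity) (by positivity)
  have hN : HasSum (fun p : ℕ × ℕ × ℕ × ℕ => g (p.1 + (p.2.1 + (p.2.2.1 + p.2.2.2))) *
      (coeff p.1 (genA q) * (coeff p.2.1 (genB q) * (coeff p.2.2.1 (genK q)
        * coeff p.2.2.2 (genD q))))) (∑' p, F p) := by
    -- The index `k` enters as `l = 2k`; off the range of `ψ`, `l` is odd and the coefficient of
    -- `genK` vanishes.
    let ψ : (ℕ × ℕ × ℕ) × ℕ → ℕ × ℕ × ℕ × ℕ := fun p => (p.1.1, p.1.2.1, 2 * p.1.2.2, p.2)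
    have hψ : Function.Injective ψ := by
      rintro ⟨⟨i, j, k⟩, s⟩ ⟨⟨i', j', k'⟩, s'⟩ h
      simp only [ψ, Prod.mk.injEq] at h ⊢
      omega
    rw [← hψ.hasSum_iff]
    · refine hasSum_of_eq hF.hasSum ?_ rfl
      rintro ⟨⟨i, j, k⟩, s⟩
      simp only [ψ, F, Function.comp_apply, nahmWeight, genA, genB, genK, coeff_mk]
      rw [if_pos (by simp), Nat.mul_div_cancel_left _ two_pos,
        show i + (j + (2 * k + s)) = i + j + 2 * k + s by ring]
      ring
    · rintro ⟨i, j, l, s⟩ hx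
      have : ¬ Even l := by
        rintro ⟨k, rfl⟩
        exact hx ⟨((i, j, k), s), by simp [ψ, two_mul]⟩
      simp [genK, this]
  have hm := hasSum_convolution_four hN
  have hprod : genA q * (genB q * (genK q * genD q)) = genA q ^ 2 * genK q := by
    rw [← genB_mul_genD hq] ; ring
  rw [hprod] at hm
  simp only [coeff_genA_sq_mul_genK hq] at hm
  have hval : ∑' p, F p = a := hm.unique ha
  have hrow : ∀ t : ℕ × ℕ × ℕ, HasSum (fun s => F (t, s))
      (nahmWeight q t * q ^ (t.1 + t.2.1 + 2 * t.2.2 + δ) ^ 2 * (qPochInf (q ^ 2) (q ^ 2))⁻¹) := by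
    rintro ⟨i, j, k⟩
    have h := (hasSum_durfeeTerm (norm_sq_lt_one hq) (i + j + 2 * k + δ)).mul_left
      (nahmWeight q (i, j, k) * q ^ (i + j + 2 * k + δ) ^ 2)
    refine hasSum_of_eq h (fun s => ?_) (by simp)
    simp only [F, g, genD, coeff_mk, durfeeTerm]
    rw [show s + (i + j + 2 * k + δ) = i + j + 2 * k + s + δ by ring, ← pow_mul]
    rw [show (i + j + 2 * k + s + δ) ^ 2 = (i + j + 2 * k + δ) ^ 2
      + (s ^ 2 + 2 * ((i + j + 2 * k + δ) * s)) by ring]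
    ring
  have h := (hF.hasSum.prod_fiberwise hrow).mul_left (qPochInf (q ^ 2) (q ^ 2))
  rw [hval] at h
  have := qPochInf_self_ne_zero (norm_sq_lt_one hq)
  refine hasSum_of_eq h (fun t => ?_) rfl
  field_simp

/-- Here the recurrence replaces `(1 - q^{2m+2}) β_{m+1}` by `1/(q)_m² - β_m`. The first part sums
to `1 / (q; q)_∞` by Durfee squares, which turns the coefficient `-1/4` into `3/4`. -/
theorem hasSum_nahmTerm₁ {q : ℂ} (hq : ‖q‖ < 1) :
    HasSum (nahmTerm₁ q)
        (1 / 4 * (3 * (qPochInf (q ^ 2) (q ^ 2) / qPochInf q q)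
          + qPochInf q q ^ 3 / qPochInf (q ^ 2) (q ^ 2))) := by
  have hβ0 : HasSum (fun n => q ^ n ^ 2 * baileyBeta q n)
      ((1 / 4 - (qPochInf q q ^ 2 / qPochInf (q ^ 2) (q ^ 2)) ^ 2 / 4) * (qPochInf q q)⁻¹) := by
    -- The term at `n = 0` is zero, because `baileyBeta q 0` is an empty sum.
    rw [← hasSum_nat_add_iff' 1]
    simpa [baileyBeta] using hasSum_baileyBeta hq
  have hsub := (hasSum_durfeeTerm hq 0).sub hβ0
  have h := hasSum_nahmWeight hq 0 (a := (qPochInf q q)⁻¹ - (1 / 4 -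
      (qPochInf q q ^ 2 / qPochInf (q ^ 2) (q ^ 2)) ^ 2 / 4) * (qPochInf q q)⁻¹) (by
    refine hasSum_of_eq hsub (fun m => ?_) rfl
    have hb := baileyBeta_add_succ hq m
    have hne := inv_mul_cancel₀ (qPoch_self_ne_zero (norm_sq_lt_one hq) m)
    rw [durfeeTerm, qPoch_self_succ, add_zero, zero_mul, add_zero, ← pow_mul,
      show 2 * (m + 1) = 2 * m + 2 by ring]
    linear_combination
      (q ^ m ^ 2 * (1 - q ^ (2 * m + 2)) * baileyBeta q (m + 1)) * hne + q ^ m ^ 2 * hb)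
  have h1 := qPochInf_self_ne_zero hq
  have h2 := qPochInf_self_ne_zero (norm_sq_lt_one hq)
  refine hasSum_of_eq h (nahmTerm₁_eq q) ?_
  field_simp
  ring

theorem hasSum_nahmTerm₂ {q : ℂ} (hq0 : q ≠ 0) (hq : ‖q‖ < 1) :
    HasSum (nahmTerm₂ q)
        (1 / 4 * q⁻¹ * (qPochInf (q ^ 2) (q ^ 2) / qPochInf q q
          - qPochInf q q ^ 3 / qPochInf (q ^ 2) (q ^ 2))) := by
  have h := (hasSum_nahmWeight hq 1 (a := (1 / 4 -
      (qPochInf q q ^ 2 / qPochInf (q ^ 2) (q ^ 2)) ^ 2 / 4) * (qPochInf q q)⁻¹) (by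
    refine hasSum_of_eq (hasSum_baileyBeta hq) (fun m => ?_) rfl
    have hne := qPoch_self_ne_zero (norm_sq_lt_one hq) (m + 1)
    field_simp)).mul_left q⁻¹
  have h1 := qPochInf_self_ne_zero hq
  have h2 := qPochInf_self_ne_zero (norm_sq_lt_one hq)
  refine hasSum_of_eq h (nahmTerm₂_eq hq0) ?_
  field_simp

end Evaluation

/-! ### Modularity of the eta quotients. -/

section Modularity

open UpperHalfPlane ModularForm Matrix.SpecialLinearGroup

theorem discriminant_slash (γ : SL(2, ℤ)) :
    ModularForm.discriminant ∣[(12 : ℤ)] γ = ModularForm.discriminant :=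
  SlashInvariantForm.slash_action_generators_SL2Z discriminant_S_invariant
    discriminant_T_invariant γ

/-- The real matrix `!![a, b; 0, d]` with positive diagonal. -/
noncomputable def upperTriGL (a b d : ℝ) (ha : 0 < a) (hd : 0 < d) : GL (Fin 2) ℝ :=
  Matrix.GeneralLinearGroup.mkOfDetNeZero !![a, b; 0, d]
    (by simpa using ⟨ha.ne', hd.ne'⟩)

section

variable {a b d : ℝ} {ha : 0 < a} {hd : 0 < d}

theorem upperTriGL_coe :
    (upperTriGL a b d ha hd : Matrix (Fin 2) (Fin 2) ℝ) = !![a, b; 0, d] := rfl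

theorem upperTriGL_det : (upperTriGL a b d ha hd).det.val = a * d := by
  simp [upperTriGL_coe]

theorem upperTriGL_det_pos : 0 < (upperTriGL a b d ha hd).det.val := by
  rw [upperTriGL_det]; positivity

theorem upperTriGL_denom (τ : ℍ) : denom (upperTriGL a b d ha hd) τ = d := by
  simp [denom, upperTriGL_coe]

theorem coe_upperTriGL_smul (τ : ℍ) :
    ((upperTriGL a b d ha hd • τ : ℍ) : ℂ) = (a * τ + b) / d := by
  rw [coe_smul_of_det_pos upperTriGL_det_pos, upperTriGL_denom]
  simp [num, upperTriGL_coe]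

theorem im_upperTriGL_smul (τ : ℍ) : (upperTriGL a b d ha hd • τ : ℍ).im = a / d * τ.im := by
  rw [← coe_im, coe_upperTriGL_smul, Complex.div_ofReal_im]
  simp
  ring

theorem slash_upperTriGL (f : ℍ → ℂ) (k : ℤ) (τ : ℍ) :
    (f ∣[k] upperTriGL a b d ha hd) τ
      = f (upperTriGL a b d ha hd • τ) * ((a * d : ℝ) : ℂ) ^ (k - 1) * (d : ℂ) ^ (-k) := by
  rw [slash_apply, upperTriGL_denom, upperTriGL_det, σ, if_pos upperTriGL_det_pos,
    abs_of_pos (mul_pos ha hd)]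
  rfl

end

/-- In `Δ = q ∏ (1 - q^n)^24` the product tends to 1 at `i∞`. -/
theorem exists_norm_discriminant_bounds :
    ∃ A : ℝ, ∀ τ : ℍ, A ≤ τ.im →
      1 / 2 * Real.exp (-2 * Real.pi * τ.im) ≤ ‖ModularForm.discriminant τ‖ ∧
      ‖ModularForm.discriminant τ‖ ≤ 2 * Real.exp (-2 * Real.pi * τ.im) := by
  have hprod := tendsto_atImInfty_tprod_one_sub_eta_q_pow.norm
  rw [norm_one] at hprod
  have h1 := hprod.eventually (Icc_mem_nhds (show (1 / 2 : ℝ) < 1 by norm_num) one_lt_two)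
  obtain ⟨A, hA⟩ := (atImInfty_mem _).mp h1
  refine ⟨A, fun τ hτ => ?_⟩
  obtain ⟨hl, hu⟩ : 1 / 2 ≤ ‖∏' n, (1 - eta_q n τ) ^ 24‖ ∧ ‖∏' n, (1 - eta_q n τ) ^ 24‖ ≤ 2 :=
    hA τ hτ
  have hq : ‖Function.Periodic.qParam 1 (τ : ℂ)‖ = Real.exp (-2 * Real.pi * τ.im) := by
    simp [Function.Periodic.qParam, Complex.norm_exp]
  rw [discriminant_eq_q_prod, norm_mul, hq]
  constructor <;> nlinarith [Real.exp_pos (-2 * Real.pi * τ.im)]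

/-- An upper triangular translate of the discriminant is comparable with
`exp (-2π (a / d) Im τ)` near `i∞`. -/
theorem exists_norm_discriminant_slash_bounds (a b d : ℝ) (ha : 0 < a) (hd : 0 < d) :
    ∃ A c C : ℝ, 0 < c ∧ 0 < C ∧ ∀ τ : ℍ, A ≤ τ.im →
      c * Real.exp (-2 * Real.pi * (a / d * τ.im))
        ≤ ‖(ModularForm.discriminant ∣[(12 : ℤ)] upperTriGL a b d ha hd) τ‖ ∧
      ‖(ModularForm.discriminant ∣[(12 : ℤ)] upperTriGL a b d ha hd) τ‖
        ≤ C * Real.exp (-2 * Real.pi * (a / d * τ.im)) := by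
  obtain ⟨A, hA⟩ := exists_norm_discriminant_bounds
  obtain ⟨K, hKdef⟩ : ∃ K : ℝ, K = ‖((a * d : ℝ) : ℂ) ^ ((12 : ℤ) - 1) * (d : ℂ) ^ (-(12 : ℤ))‖ :=
    ⟨_, rfl⟩
  have hK : 0 < K := by
    rw [hKdef]
    refine norm_pos_iff.mpr (mul_ne_zero (zpow_ne_zero _ ?_) (zpow_ne_zero _ ?_))
    · exact_mod_cast (mul_pos ha hd).ne'
    · exact_mod_cast hd.ne'
  refine ⟨A * (d / a), 1 / 2 * K, 2 * K, by positivity, by positivity, fun τ hτ => ?_⟩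
  have him : A ≤ (upperTriGL a b d ha hd • τ : ℍ).im := by
    rw [im_upperTriGL_smul]
    calc A = a / d * (A * (d / a)) := by field_simp
      _ ≤ a / d * τ.im := by gcongr
  obtain ⟨hl, hu⟩ := hA _ him
  rw [im_upperTriGL_smul] at hl hu
  have hnorm : ‖(ModularForm.discriminant ∣[(12 : ℤ)] upperTriGL a b d ha hd) τ‖
      = ‖ModularForm.discriminant (upperTriGL a b d ha hd • τ)‖ * K := by
    rw [slash_upperTriGL, mul_assoc, norm_mul, hKdef]
  rw [hnorm, mul_right_comm, mul_right_comm 2]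
  exact ⟨mul_le_mul_of_nonneg_right hl hK.le, mul_le_mul_of_nonneg_right hu hK.le⟩

/-- `2¹¹ Δ(2τ)`, as a slash translate of `Δ`. -/
noncomputable def discriminantTwo : ℍ → ℂ :=
  ModularForm.discriminant ∣[(12 : ℤ)] upperTriGL 2 0 1 two_pos one_pos

/-- The four equations say `diag(2,1) γ = γ' T`, and `Δ` absorbs `γ'`. -/
theorem discriminantTwo_slash_eq {γ γ' : SL(2, ℤ)} {a b d : ℝ} {ha : 0 < a} {hd : 0 < d}
    (h00 : 2 * (γ 0 0 : ℝ) = γ' 0 0 * a) (h01 : 2 * (γ 0 1 : ℝ) = γ' 0 0 * b + γ' 0 1 * d)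
    (h10 : (γ 1 0 : ℝ) = γ' 1 0 * a) (h11 : (γ 1 1 : ℝ) = γ' 1 0 * b + γ' 1 1 * d) :
    discriminantTwo ∣[(12 : ℤ)] γ
      = ModularForm.discriminant ∣[(12 : ℤ)] upperTriGL a b d ha hd := by
  have hmat : upperTriGL 2 0 1 two_pos one_pos * (mapGL ℝ γ)
      = (mapGL ℝ γ') * upperTriGL a b d ha hd := by
    ext i j
    fin_cases i <;> fin_cases j <;>
      simp [upperTriGL_coe, Matrix.mul_apply, Fin.sum_univ_two, h00, h01, h10, h11]
  rw [discriminantTwo, SL_slash, ← SlashAction.slash_mul]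
  erw [hmat]
  rw [SlashAction.slash_mul]
  congr 1
  exact discriminant_slash γ'

theorem discriminantTwo_slash_of_mem_Gamma0 {γ : SL(2, ℤ)} (hγ : γ ∈ CongruenceSubgroup.Gamma0 2) :
    discriminantTwo ∣[(12 : ℤ)] γ = discriminantTwo := by
  have hdvd : (2 : ℤ) ∣ γ 1 0 := by
    have := (ZMod.intCast_zmod_eq_zero_iff_dvd (γ 1 0) 2).mp (CongruenceSubgroup.Gamma0_mem.mp hγ)
    exact_mod_cast this
  obtain ⟨c, hc⟩ := hdvd
  have hdet := γ.det_coe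
  rw [Matrix.det_fin_two] at hdet
  let γ' : SL(2, ℤ) := ⟨!![γ 0 0, 2 * γ 0 1; c, γ 1 1], by
    rw [Matrix.det_fin_two_of]; rw [hc] at hdet; linear_combination hdet⟩
  refine discriminantTwo_slash_eq (γ' := γ') ?_ ?_ ?_ ?_ <;> simp [γ', hc] <;> ring

/-- Hermite normal form of `diag(2,1) γ`: the parities of the bottom row of `γ` select one of three
upper triangular matrices of determinant 2. -/
theorem exists_discriminantTwo_slash_eq (γ : SL(2, ℤ)) :
    ∃ (a b d : ℝ) (ha : 0 < a) (hd : 0 < d), a / d ≤ 2 ∧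
      discriminantTwo ∣[(12 : ℤ)] γ
        = ModularForm.discriminant ∣[(12 : ℤ)] upperTriGL a b d ha hd := by
  have hdet := γ.det_coe
  rw [Matrix.det_fin_two] at hdet
  rcases Int.even_or_odd' (γ 1 0) with ⟨c, hc | hc⟩
  · let γ' : SL(2, ℤ) := ⟨!![γ 0 0, 2 * γ 0 1; c, γ 1 1], by
      rw [Matrix.det_fin_two_of]; rw [hc] at hdet; linear_combination hdet⟩
    refine ⟨2, 0, 1, two_pos, one_pos, by norm_num,
      discriminantTwo_slash_eq (γ' := γ') ?_ ?_ ?_ ?_⟩ <;> simp [γ', hc] <;> ring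
  · rcases Int.even_or_odd' (γ 1 1) with ⟨d, hd | hd⟩
    · let γ' : SL(2, ℤ) := ⟨!![2 * γ 0 0, γ 0 1; γ 1 0, d], by
        rw [Matrix.det_fin_two_of]; rw [hd] at hdet; linear_combination hdet⟩
      refine ⟨1, 0, 2, one_pos, two_pos, by norm_num,
        discriminantTwo_slash_eq (γ' := γ') ?_ ?_ ?_ ?_⟩ <;> simp [γ', hd] <;> ring
    · let γ' : SL(2, ℤ) := ⟨!![2 * γ 0 0, γ 0 1 - γ 0 0; γ 1 0, d - c], by
        rw [Matrix.det_fin_two_of]; rw [hd, hc] at hdet; rw [hc]; linear_combination hdet⟩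
      refine ⟨1, 1, 2, one_pos, two_pos, by norm_num,
        discriminantTwo_slash_eq (γ' := γ') ?_ ?_ ?_ ?_⟩ <;> simp [γ', hd, hc] <;> ring

theorem two_mul_mem (τ : ℍ) : 2 * (τ : ℂ) ∈ upperHalfPlaneSet := by
  simpa using τ.im_pos

theorem discriminantTwo_apply (τ : ℍ) :
    discriminantTwo τ = 2 ^ 11 * ModularForm.eta (2 * (τ : ℂ)) ^ 24 := by
  rw [discriminantTwo, slash_upperTriGL, ModularForm.discriminant, coe_upperTriGL_smul]
  norm_num
  ring

theorem discriminantTwo_ne_zero (τ : ℍ) : discriminantTwo τ ≠ 0 := by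
  rw [discriminantTwo_apply]
  exact mul_ne_zero (by norm_num) (pow_ne_zero _ (eta_ne_zero (two_mul_mem τ)))

theorem etaQuotient₀_pow (τ : ℍ) :
    2 ^ 11 * (etaQuotient₀ τ ^ 24 * ModularForm.discriminant τ) = discriminantTwo τ := by
  have h1 := eta_ne_zero τ.2
  rw [discriminantTwo_apply, etaQuotient₀, ModularForm.discriminant]
  field_simp

theorem etaQuotient₁_pow (τ : ℍ) :
    etaQuotient₁ τ ^ 24 * discriminantTwo τ = 2 ^ 11 * ModularForm.discriminant τ ^ 3 := by
  have h1 := eta_ne_zero (two_mul_mem τ)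
  rw [discriminantTwo_apply, etaQuotient₁, ModularForm.discriminant]
  field_simp

theorem etaQuotient₀_slash_pow (γ : SL(2, ℤ)) (τ : ℍ) :
    2 ^ 11 * ((etaQuotient₀ ∣[(0 : ℤ)] γ) τ ^ 24 * ModularForm.discriminant τ)
      = (discriminantTwo ∣[(12 : ℤ)] γ) τ := by
  have h := congrFun (discriminant_slash γ) τ
  rw [SL_slash_apply] at h
  rw [SL_slash_apply, SL_slash_apply, ← etaQuotient₀_pow, ← h]
  simp
  ring

theorem etaQuotient₁_slash_pow (γ : SL(2, ℤ)) (τ : ℍ) :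
    (etaQuotient₁ ∣[(1 : ℤ)] γ) τ ^ 24 * (discriminantTwo ∣[(12 : ℤ)] γ) τ
      = 2 ^ 11 * ModularForm.discriminant τ ^ 3 := by
  have h := congrFun (discriminant_slash γ) τ
  rw [SL_slash_apply] at h
  have h2 := etaQuotient₁_pow (γ • τ)
  rw [SL_slash_apply, SL_slash_apply, ← h]
  generalize denom (γ : GL (Fin 2) ℝ) τ = x
  have e12 : x ^ (-12 : ℤ) = x⁻¹ ^ 12 := by rw [zpow_neg, ← inv_zpow]; exact zpow_natCast _ 12
  rw [e12, zpow_neg_one]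
  linear_combination x⁻¹ ^ 36 * h2

theorem mdifferentiable_eta_two_mul : MDiff (fun τ : ℍ => ModularForm.eta (2 * (τ : ℂ))) := by
  rw [UpperHalfPlane.mdifferentiable_iff]
  have h : DifferentiableOn ℂ (fun z => ModularForm.eta (2 * z)) upperHalfPlaneSet := fun z hz =>
    ((differentiableAt_eta_of_mem_upperHalfPlaneSet (two_mul_mem ⟨z, hz⟩)).comp z
      (by fun_prop : DifferentiableAt ℂ (fun z : ℂ => 2 * z) z)).differentiableWithinAt
  exact h.congr fun z hz => by simp [ofComplex_apply_of_im_pos hz]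

theorem mdifferentiable_eta : MDiff (fun τ : ℍ => ModularForm.eta (τ : ℂ)) := by
  rw [UpperHalfPlane.mdifferentiable_iff]
  have h : DifferentiableOn ℂ ModularForm.eta upperHalfPlaneSet := fun z hz =>
    (differentiableAt_eta_of_mem_upperHalfPlaneSet hz).differentiableWithinAt
  exact h.congr fun z hz => by simp [ofComplex_apply_of_im_pos hz]

theorem mdifferentiable_etaQuotient₀ : MDiff etaQuotient₀ := by
  have h1 := UpperHalfPlane.mdifferentiable_iff.mp mdifferentiable_eta
  have h2 := UpperHalfPlane.mdifferentiable_iff.mp mdifferentiable_eta_two_mul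
  rw [UpperHalfPlane.mdifferentiable_iff]
  exact h2.div h1 fun z _ => eta_ne_zero (ofComplex z).2

theorem mdifferentiable_etaQuotient₁ : MDiff etaQuotient₁ := by
  have h1 := UpperHalfPlane.mdifferentiable_iff.mp mdifferentiable_eta
  have h2 := UpperHalfPlane.mdifferentiable_iff.mp mdifferentiable_eta_two_mul
  rw [UpperHalfPlane.mdifferentiable_iff]
  exact (h1.pow 3).div h2 fun z _ => eta_ne_zero (two_mul_mem (ofComplex z))

theorem etaQuotient₀_ne_zero (τ : ℍ) : etaQuotient₀ τ ≠ 0 :=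
  div_ne_zero (eta_ne_zero (two_mul_mem τ)) (eta_ne_zero τ.2)

theorem etaQuotient₁_ne_zero (τ : ℍ) : etaQuotient₁ τ ≠ 0 :=
  div_ne_zero (pow_ne_zero _ (eta_ne_zero τ.2)) (eta_ne_zero (two_mul_mem τ))

/-- Continuous functions on the upper half-plane with equal `n`-th powers differ by a constant root
of unity. -/
theorem exists_eq_smul_of_pow_eq {f g : ℍ → ℂ} (hf : Continuous f) (hg : Continuous g)
    (hne : ∀ τ, f τ ≠ 0) {n : ℕ} (hn : 0 < n) (h : ∀ τ, g τ ^ n = f τ ^ n) :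
    ∃ c : ℂ, c ^ n = 1 ∧ g = c • f := by
  have hfin : {c : ℂ | c ^ n = 1}.Finite := by
    refine (Polynomial.nthRoots n (1 : ℂ)).toFinset.finite_toSet.subset fun c hc => ?_
    simpa [Polynomial.mem_nthRoots hn] using hc
  obtain ⟨c, hc, hcf⟩ := (isPreconnected_univ (α := ℍ)).eqOn_const_of_mapsTo
    (T := {c : ℂ | c ^ n = 1}) (f := fun τ => g τ / f τ) hfin.isDiscrete
    (hg.div hf hne).continuousOn
    (fun τ _ => by
      simp only [Set.mem_ofPred_eq, div_pow, h]
      exact div_self (pow_ne_zero _ (hne τ))) ⟨1, by simp⟩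
  refine ⟨c, hc, funext fun τ => ?_⟩
  have := hcf (Set.mem_univ τ)
  simp only [Function.const_apply] at this
  rw [Pi.smul_apply, smul_eq_mul, ← this, div_mul_cancel₀ _ (hne τ)]

/-- A nonvanishing holomorphic function which transforms under `G` up to `n`-th roots of unity is
invariant under a subgroup of finite index. -/
theorem exists_finiteIndex_slash_eq {f : ℍ → ℂ} {k : ℤ} {n : ℕ} (hn : 0 < n) (hf : MDiff f)
    (hne : ∀ τ, f τ ≠ 0) (G : Subgroup SL(2, ℤ)) [G.FiniteIndex]
    (h : ∀ γ ∈ G, ∀ τ, (f ∣[k] γ) τ ^ n = f τ ^ n) :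
    ∃ Γ : Subgroup SL(2, ℤ), Γ.FiniteIndex ∧ ∀ γ ∈ Γ, f ∣[k] γ = f := by
  have hc : ∀ γ : G, ∃ c : ℂ, c ^ n = 1 ∧ f ∣[k] (γ : SL(2, ℤ)) = c • f := fun γ =>
    exists_eq_smul_of_pow_eq hf.continuous (hf.slash k _).continuous hne hn (h γ γ.2)
  choose χ hχ hχf using hc
  have hinj : ∀ {a b : ℂ}, a • f = b • f → a = b := fun {a b} hab => by
    have := congrFun hab I
    simpa [hne I] using this
  let φ : G →* ℂ :=
    { toFun := χ
      map_one' := hinj (by rw [← hχf]; simp)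
      map_mul' := fun γ γ' => hinj (by
        rw [← hχf, Subgroup.coe_mul, SlashAction.slash_mul, hχf, SL_smul_slash, hχf, smul_smul]) }
  let ψ : G →* ℂˣ := φ.toHomUnits
  have : NeZero n := ⟨hn.ne'⟩
  have hrange : ψ.range ≤ rootsOfUnity n ℂ := by
    rintro _ ⟨γ, rfl⟩
    rw [mem_rootsOfUnity]
    ext
    exact hχ γ
  -- A finite image makes the kernel of the character of finite index in `G`, hence in `SL(2, ℤ)`.
  have : Finite ψ.range := Finite.of_injective _ (Subgroup.inclusion_injective hrange)
  refine ⟨ψ.ker.map G.subtype, ⟨?_⟩, ?_⟩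
  · rw [Subgroup.index_map_subtype]
    exact mul_ne_zero Subgroup.FiniteIndex.index_ne_zero Subgroup.FiniteIndex.index_ne_zero
  · rintro _ ⟨γ, hγ, rfl⟩
    have : χ γ = 1 := congrArg Units.val (MonoidHom.mem_ker.mp hγ)
    have h1 := hχf γ
    rwa [this, one_smul] at h1

theorem etaQuotient₀_slash_pow_eq {γ : SL(2, ℤ)} (hγ : γ ∈ CongruenceSubgroup.Gamma0 2) (τ : ℍ) :
    (etaQuotient₀ ∣[(0 : ℤ)] γ) τ ^ 24 = etaQuotient₀ τ ^ 24 := by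
  have h := etaQuotient₀_slash_pow γ τ
  rw [discriminantTwo_slash_of_mem_Gamma0 hγ, ← etaQuotient₀_pow] at h
  exact mul_right_cancel₀ (discriminant_ne_zero τ) (mul_left_cancel₀ (by norm_num) h)

theorem etaQuotient₁_slash_pow_eq {γ : SL(2, ℤ)} (hγ : γ ∈ CongruenceSubgroup.Gamma0 2) (τ : ℍ) :
    (etaQuotient₁ ∣[(1 : ℤ)] γ) τ ^ 24 = etaQuotient₁ τ ^ 24 := by
  have h := etaQuotient₁_slash_pow γ τ
  rw [discriminantTwo_slash_of_mem_Gamma0 hγ, ← etaQuotient₁_pow] at h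
  exact mul_right_cancel₀ (discriminantTwo_ne_zero τ) h

theorem isBoundedAtImInfty_of_pow {f : ℍ → ℂ} {n : ℕ} (hn : n ≠ 0) {A M : ℝ}
    (h : ∀ τ : ℍ, A ≤ τ.im → ‖f τ ^ n‖ ≤ M) : IsBoundedAtImInfty f := by
  rw [isBoundedAtImInfty_iff]
  refine ⟨max 1 M, A, fun τ hτ => ?_⟩
  rcases le_total ‖f τ‖ 1 with h1 | h1
  · exact h1.trans (le_max_left _ _)
  · refine le_trans ?_ ((h τ hτ).trans (le_max_right _ _))
    rw [norm_pow]
    exact le_self_pow₀ h1 hn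

/-- The 24th power has size about `exp(2π(1 - a/d) Im τ)`, so one factor `q` is more than enough. -/
theorem isBoundedAtImInfty_etaQuotient₀_slash (γ : SL(2, ℤ)) :
    IsBoundedAtImInfty (fun τ : ℍ => Complex.exp (2 * Real.pi * Complex.I * (τ : ℂ)) ^ 1
      * (etaQuotient₀ ∣[(0 : ℤ)] γ) τ) := by
  obtain ⟨a, b, d, ha, hd, -, hγ⟩ := exists_discriminantTwo_slash_eq γ
  obtain ⟨A₁, c, C, hc, hC, hA₁⟩ := exists_norm_discriminant_slash_bounds a b d ha hd
  obtain ⟨A₂, hA₂⟩ := exists_norm_discriminant_bounds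
  refine isBoundedAtImInfty_of_pow (n := 24) (by norm_num) (A := max A₁ A₂) (M := 2 * C)
    fun τ hτ => ?_
  have hu := (hA₁ τ ((le_max_left _ _).trans hτ)).2
  have hl := (hA₂ τ ((le_max_right _ _).trans hτ)).1
  have h := congrArg norm (etaQuotient₀_slash_pow γ τ)
  rw [hγ, norm_mul, norm_mul, norm_pow, norm_pow] at h
  have hq : ‖Complex.exp (2 * Real.pi * Complex.I * (τ : ℂ))‖
      = Real.exp (-2 * Real.pi * τ.im) := by
    simp [Complex.norm_exp]
  have he : Real.exp (-2 * Real.pi * (a / d * τ.im)) ≤ 1 := by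
    rw [Real.exp_le_one_iff]
    have := τ.im_pos
    have : 0 ≤ 2 * Real.pi * (a / d * τ.im) := by positivity
    linarith
  rw [mul_pow, norm_mul, pow_one, norm_pow, norm_pow, hq]
  set x := ‖(etaQuotient₀ ∣[(0 : ℤ)] γ) τ‖ ^ 24
  set y := Real.exp (-2 * Real.pi * τ.im)
  have hx : 0 ≤ x := by positivity
  have hy : 0 < y := Real.exp_pos _
  have hy1 : y ≤ 1 := by
    rw [Real.exp_le_one_iff]
    have := τ.im_pos
    have : 0 ≤ 2 * Real.pi * τ.im := by positivity
    linarith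
  have h2 : y ^ 24 ≤ y := pow_le_of_le_one hy.le hy1 (by norm_num)
  have h3 : x * (1 / 2 * y) ≤ C := by
    calc x * (1 / 2 * y) ≤ x * ‖ModularForm.discriminant τ‖ := by gcongr
      _ ≤ ‖(2 : ℂ)‖ ^ 11 * (x * ‖ModularForm.discriminant τ‖) :=
        le_mul_of_one_le_left (by positivity) (by norm_num)
      _ ≤ C * Real.exp (-2 * Real.pi * (a / d * τ.im)) := h.trans_le hu
      _ ≤ C := mul_le_of_le_one_right hC.le he
  nlinarith [mul_le_mul_of_nonneg_right h2 hx]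

/-- The 24th power has size about `exp(-2π(3 - a/d) Im τ)`, and `a/d ≤ 2 < 3`. -/
theorem isBoundedAtImInfty_etaQuotient₁_slash (γ : SL(2, ℤ)) :
    IsBoundedAtImInfty (etaQuotient₁ ∣[(1 : ℤ)] γ) := by
  obtain ⟨a, b, d, ha, hd, had, hγ⟩ := exists_discriminantTwo_slash_eq γ
  obtain ⟨A₁, c, C, hc, hC, hA₁⟩ := exists_norm_discriminant_slash_bounds a b d ha hd
  obtain ⟨A₂, hA₂⟩ := exists_norm_discriminant_bounds
  refine isBoundedAtImInfty_of_pow (n := 24) (by norm_num) (A := max A₁ A₂)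
    -- `2^14 = 2^11 · 2^3`: the normalisation of `discriminantTwo` times the cube of the upper bound
    -- 2 for `|Δ/q|`.
    (M := 2 ^ 14 / c) fun τ hτ => ?_
  have hl := (hA₁ τ ((le_max_left _ _).trans hτ)).1
  have hu := (hA₂ τ ((le_max_right _ _).trans hτ)).2
  have h := congrArg norm (etaQuotient₁_slash_pow γ τ)
  rw [hγ, norm_mul, norm_mul, norm_pow _ 3, norm_pow _ 11] at h
  set x := ‖(etaQuotient₁ ∣[(1 : ℤ)] γ) τ ^ 24‖
  set y := Real.exp (-2 * Real.pi * τ.im) with hy_def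
  have hx : 0 ≤ x := norm_nonneg _
  have hy : 0 < y := Real.exp_pos _
  have he : y ^ 3 ≤ Real.exp (-2 * Real.pi * (a / d * τ.im)) := by
    rw [hy_def, ← Real.exp_nat_mul, Real.exp_le_exp]
    have h1 := mul_le_mul_of_nonneg_right had τ.im_pos.le
    have h2 := τ.im_pos
    push_cast
    nlinarith [Real.pi_pos, mul_pos Real.pi_pos h2]
  have hD := pow_le_pow_left₀ (norm_nonneg _) hu 3
  have h11 : ‖(2 : ℂ)‖ ^ 11 = 2 ^ 11 := by rw [RCLike.norm_ofNat]
  rw [h11] at h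
  have h3 : x * c * y ^ 3 ≤ 2 ^ 14 * y ^ 3 := by
    have e1 := mul_le_mul_of_nonneg_left (mul_le_mul_of_nonneg_left he hc.le) hx
    have e2 := mul_le_mul_of_nonneg_left hl hx
    rw [mul_pow] at hD
    linarith
  rw [le_div_iff₀ hc]
  exact le_of_mul_le_mul_right h3 (by positivity)

theorem exists_finiteIndex_modular :
    ∃ Γ : Subgroup SL(2, ℤ), Γ.FiniteIndex ∧
      IsWeaklyHolomorphicModularForm Γ 0 etaQuotient₀ ∧
      ∃ F : ModularForm (Γ.map (Matrix.SpecialLinearGroup.mapGL ℝ)) 1, ⇑F = etaQuotient₁ := by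
  obtain ⟨Γ₀, hΓ₀, h₀⟩ := exists_finiteIndex_slash_eq (n := 24) (by norm_num)
    mdifferentiable_etaQuotient₀ etaQuotient₀_ne_zero (CongruenceSubgroup.Gamma0 2)
    fun γ hγ => etaQuotient₀_slash_pow_eq hγ
  obtain ⟨Γ₁, hΓ₁, h₁⟩ := exists_finiteIndex_slash_eq (n := 24) (by norm_num)
    mdifferentiable_etaQuotient₁ etaQuotient₁_ne_zero (CongruenceSubgroup.Gamma0 2)
    fun γ hγ => etaQuotient₁_slash_pow_eq hγ
  have hfin : (Γ₀ ⊓ Γ₁).FiniteIndex := inferInstance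
  refine ⟨Γ₀ ⊓ Γ₁, hfin, ⟨mdifferentiable_etaQuotient₀, fun γ hγ => h₀ γ hγ.1,
    fun γ => ⟨1, isBoundedAtImInfty_etaQuotient₀_slash γ⟩⟩, ?_⟩
  exact ⟨{ toFun := etaQuotient₁
           slash_action_eq' := by
             rintro _ ⟨γ, hγ, rfl⟩
             exact h₁ γ hγ.2
           holo' := mdifferentiable_etaQuotient₁
           bdd_at_cusps' := fun {c} hc => by
             rw [Subgroup.IsArithmetic.isCusp_iff_isCusp_SL2Z] at hc
             rw [OnePoint.isBoundedAt_iff_forall_SL2Z hc]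
             exact fun γ _ => isBoundedAtImInfty_etaQuotient₁_slash γ }, rfl⟩

theorem eta_eq_qPochInf (z : ℂ) :
    ModularForm.eta z = Complex.exp (2 * Real.pi * Complex.I * z / 24)
      * qPochInf (Complex.exp (2 * Real.pi * Complex.I * z))
        (Complex.exp (2 * Real.pi * Complex.I * z)) := by
  simp [ModularForm.eta, eta_q, qPochInf, Function.Periodic.qParam, pow_succ']

end Modularity

/-! ### Assembly of the theorem. -/

theorem theorem1p4 :
    (∀ q : ℂ, ‖q‖ < 1 →
      HasSum (nahmTerm₁ q)
        (1 / 4 * (3 * (qPochInf (q ^ 2) (q ^ 2) / qPochInf q q)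
          + qPochInf q q ^ 3 / qPochInf (q ^ 2) (q ^ 2)))) ∧
    (∀ q : ℂ, q ≠ 0 → ‖q‖ < 1 →
      HasSum (nahmTerm₂ q)
        (1 / 4 * q⁻¹ * (qPochInf (q ^ 2) (q ^ 2) / qPochInf q q
          - qPochInf q q ^ 3 / qPochInf (q ^ 2) (q ^ 2)))) ∧
    (∃ Γ : Subgroup SL(2, ℤ), Γ.FiniteIndex ∧
      IsWeaklyHolomorphicModularForm Γ 0 etaQuotient₀ ∧
      ∃ F : ModularForm (Γ.map (Matrix.SpecialLinearGroup.mapGL ℝ)) 1, ⇑F = etaQuotient₁) ∧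
    (∀ τ : ℍ,
      Complex.exp (2 * Real.pi * Complex.I * (τ : ℂ) / 24) *
          ∑' n, nahmTerm₁ (Complex.exp (2 * Real.pi * Complex.I * (τ : ℂ))) n
        = 3 / 4 * etaQuotient₀ τ + 1 / 4 * etaQuotient₁ τ) ∧
    (∀ τ : ℍ,
      Complex.exp (2 * Real.pi * Complex.I * (τ : ℂ) * 25 / 24) *
          ∑' n, nahmTerm₂ (Complex.exp (2 * Real.pi * Complex.I * (τ : ℂ))) n
        = 1 / 4 * etaQuotient₀ τ - 1 / 4 * etaQuotient₁ τ) := by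
  refine ⟨fun q hq => hasSum_nahmTerm₁ hq, fun q hq0 hq => hasSum_nahmTerm₂ hq0 hq,
    exists_finiteIndex_modular, fun τ => ?_, fun τ => ?_⟩
  all_goals
    have hq := UpperHalfPlane.norm_exp_two_pi_I_lt_one τ
    have hJ₁ := qPochInf_self_ne_zero hq
    have hJ₂ := qPochInf_self_ne_zero (norm_sq_lt_one hq)
    have hsq : Complex.exp (2 * Real.pi * Complex.I * (2 * (τ : ℂ)))
        = Complex.exp (2 * Real.pi * Complex.I * (τ : ℂ)) ^ 2 := by
      rw [← Complex.exp_nat_mul]; congr 1; push_cast; ring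
    -- With `r = q^{1/24}`, the prefactors of the two eta quotients are `r²/r` and `r³/r²`, both
    -- equal to `r`.
    have hr : Complex.exp (2 * Real.pi * Complex.I * (2 * (τ : ℂ)) / 24)
        = Complex.exp (2 * Real.pi * Complex.I * (τ : ℂ) / 24) ^ 2 := by
      rw [← Complex.exp_nat_mul]; congr 1; push_cast; ring
    have hr0 := Complex.exp_ne_zero (2 * Real.pi * Complex.I * (τ : ℂ) / 24)
    have hq0 := Complex.exp_ne_zero (2 * Real.pi * Complex.I * (τ : ℂ))
    rw [etaQuotient₀, etaQuotient₁, eta_eq_qPochInf, eta_eq_qPochInf, hsq, hr]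
  · rw [(hasSum_nahmTerm₁ hq).tsum_eq]
    field_simp
  -- The integer part of `25/24` cancels the factor `q⁻¹` in the second evaluation.
  · have h25 : Complex.exp (2 * Real.pi * Complex.I * (τ : ℂ) * 25 / 24)
        = Complex.exp (2 * Real.pi * Complex.I * (τ : ℂ))
          * Complex.exp (2 * Real.pi * Complex.I * (τ : ℂ) / 24) := by
      rw [← Complex.exp_add]; congr 1; ring
    rw [(hasSum_nahmTerm₂ hq0 hq).tsum_eq, h25]
    field_simp
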